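/- Cells are unit cubes of the cubic lattice. A 3D polyomino is a nonempty finite set of cells that is connected through shared faces. It is inscribed in a prism of size $a\times b\times k$ (a box of $abk$ cells in a fixed position) if it is contained in the prism and touches each of its six faces. It is minimal if no polyomino inscribed in that prism has a smaller volume (number of cells). Let $p_{3D,min}(a,b,k)$ be the number of minimal polyominoes inscribed in the $a\times b\times k$ prism, where different sets of cells are counted as different. Then, for all integers $b\ge 2$ and $k\ge 2$, $$p_{3D,min}(2,b,k)=\left[16\binom{b+k-2}{b-1}-4(b+k)\right](2b+2k-3)+4(b-2)(k-2)+\left[16(b+k-2)-12bk\right](b+k-1).$$ -/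

import Mathlib

/-- A unit cubic cell of the discrete space, given by its integer coordinates `(x, y, z)`. -/
abbrev Cell : Type := ℤ × ℤ × ℤ

/-- Two unit cubes are adjacent when they share a face: exactly one of the three coordinates
differs, and it differs by one (6-connectivity). -/
def faceGraph : SimpleGraph Cell where
  Adj p q := |p.1 - q.1| + |p.2.1 - q.2.1| + |p.2.2 - q.2.2| = 1
  symm := ⟨fun p q h => by
    rw [abs_sub_comm q.1, abs_sub_comm q.2.1, abs_sub_comm q.2.2]
    exact h⟩
  loopless := ⟨fun p h => by simp at h⟩

/-- A 3D polyomino: a finite, nonempty, face-connected set of cells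
(`SimpleGraph.Connected` includes nonemptiness). -/
def IsPolyomino (P : Finset Cell) : Prop :=
  (faceGraph.induce (P : Set Cell)).Connected

/-- `P` is a 3D polyomino inscribed in the `b × k × h` prism whose cells are the `(x, y, z)` with
`0 ≤ x < b`, `0 ≤ y < k`, `0 ≤ z < h`: it is contained in the prism and touches each of the six
faces of the prism. -/
structure IsInscribed (b k h : ℕ) (P : Finset Cell) : Prop where
  polyomino : IsPolyomino P
  subset_prism : ∀ c ∈ P, (0 ≤ c.1 ∧ c.1 < b) ∧ (0 ≤ c.2.1 ∧ c.2.1 < k) ∧ (0 ≤ c.2.2 ∧ c.2.2 < h)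
  touches_x_low : ∃ c ∈ P, c.1 = 0
  touches_x_high : ∃ c ∈ P, c.1 = (b : ℤ) - 1
  touches_y_low : ∃ c ∈ P, c.2.1 = 0
  touches_y_high : ∃ c ∈ P, c.2.1 = (k : ℤ) - 1
  touches_z_low : ∃ c ∈ P, c.2.2 = 0
  touches_z_high : ∃ c ∈ P, c.2.2 = (h : ℤ) - 1

/-- The set of 3D polyominoes inscribed in the `b × k × h` prism whose volume (number of cells) is
minimal among all polyominoes inscribed in that prism. -/
def minPolyominoes (b k h : ℕ) : Set (Finset Cell) :=
  {P | IsInscribed b k h P ∧ ∀ Q : Finset Cell, IsInscribed b k h Q → P.card ≤ Q.card}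

/-- The number of minimal 3D polyominoes inscribed in the `b × k × h` prism. The set counted is
finite, since all its members are subsets of one finite prism. -/
noncomputable def numMinPolyominoes (b k h : ℕ) : ℕ := (minPolyominoes b k h).ncard

/-! Project an inscribed polyomino P along the side of length 2. The projection M is connected and
fills a b × k rectangle. Grown cell by cell, it pays at least one cell for every new row or column,
so it has at least b + k - 1 cells. Since P reaches both layers, at least one cell of M is doubled,
that is, covered in both. Hence P has at least b + k cells, and equality forces |M| = b + k - 1 and
exactly one doubled cell v (`IsInscribed.card_ge`). Such an M (a `Slim` set) is a tree with a single
edge between any two consecutive rows or columns, and every edge of M is realised in a layer of P.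
Conversely P is recovered from M and v by choosing a layer for each of the deg v branches of M at v.
The number sought is therefore the sum of 2 ^ deg v over all slim M in the rectangle and all v in M
(`numMinPolyominoes_two`).

Slim sets are classified by `Slim.isArmedPathOrMirror`: a monotone lattice path with straight arms
at both ends, or the mirror image of such a set. Armed paths are counted with weight in two stages.
`cornerPaths` treats those ending in the last corner of a box; a Pascal-type recursion controls
their number, the weight of their last cell and their total weight. Attaching two nonempty final
arms gives the others, and hockey-stick sums yield `sum_armedPaths_eq`. Mirroring preserves weights,
and a set belonging to both families is monotone in both senses, hence the union of a full row and a
full column (`exists_eq_crossShape`). Inclusion-exclusion over these crosses finishes the count. -/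

/-! ### Slim sets and their bounding boxes -/

/-- Two cells of the square lattice share an edge. -/
def GridAdj (p q : ℤ × ℤ) : Prop :=
  (p.1 = q.1 ∧ (p.2 = q.2 + 1 ∨ q.2 = p.2 + 1)) ∨
    (p.2 = q.2 ∧ (p.1 = q.1 + 1 ∨ q.1 = p.1 + 1))

instance (p q : ℤ × ℤ) : Decidable (GridAdj p q) := by unfold GridAdj; infer_instance

theorem GridAdj.symm {p q : ℤ × ℤ} (h : GridAdj p q) : GridAdj q p := by
  unfold GridAdj at *; omega

/-- Finite sets of cells of the square lattice that arise from a single cell by repeatedly adding a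
cell which lies just outside the bounding box, next to a cell already present. The parameters are
the first and last row and the first and last column of the bounding box. -/
inductive Slim : ℤ → ℤ → ℤ → ℤ → Finset (ℤ × ℤ) → Prop
  | single (y z : ℤ) : Slim y y z z {(y, z)}
  | down {y₀ y₁ z₀ z₁ z : ℤ} {M : Finset (ℤ × ℤ)} (h : Slim y₀ y₁ z₀ z₁ M) (hm : (y₁, z) ∈ M) :
      Slim y₀ (y₁ + 1) z₀ z₁ (insert (y₁ + 1, z) M)
  | up {y₀ y₁ z₀ z₁ z : ℤ} {M : Finset (ℤ × ℤ)} (h : Slim y₀ y₁ z₀ z₁ M) (hm : (y₀, z) ∈ M) :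
      Slim (y₀ - 1) y₁ z₀ z₁ (insert (y₀ - 1, z) M)
  | right {y₀ y₁ z₀ z₁ y : ℤ} {M : Finset (ℤ × ℤ)} (h : Slim y₀ y₁ z₀ z₁ M) (hm : (y, z₁) ∈ M) :
      Slim y₀ y₁ z₀ (z₁ + 1) (insert (y, z₁ + 1) M)
  | left {y₀ y₁ z₀ z₁ y : ℤ} {M : Finset (ℤ × ℤ)} (h : Slim y₀ y₁ z₀ z₁ M) (hm : (y, z₀) ∈ M) :
      Slim y₀ y₁ (z₀ - 1) z₁ (insert (y, z₀ - 1) M)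

/-- `M` lies in the given box and meets its four sides. -/
structure FillsBox (y₀ y₁ z₀ z₁ : ℤ) (M : Finset (ℤ × ℤ)) : Prop where
  sub : ∀ c ∈ M, y₀ ≤ c.1 ∧ c.1 ≤ y₁ ∧ z₀ ≤ c.2 ∧ c.2 ≤ z₁
  top : ∃ z, (y₀, z) ∈ M
  bot : ∃ z, (y₁, z) ∈ M
  left : ∃ y, (y, z₀) ∈ M
  right : ∃ y, (y, z₁) ∈ M

theorem FillsBox.le_rows {y₀ y₁ z₀ z₁ : ℤ} {M : Finset (ℤ × ℤ)} (h : FillsBox y₀ y₁ z₀ z₁ M) :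
    y₀ ≤ y₁ := by
  obtain ⟨z, hz⟩ := h.top
  have := h.sub _ hz
  omega

theorem FillsBox.le_cols {y₀ y₁ z₀ z₁ : ℤ} {M : Finset (ℤ × ℤ)} (h : FillsBox y₀ y₁ z₀ z₁ M) :
    z₀ ≤ z₁ := by
  obtain ⟨z, hz⟩ := h.left
  have := h.sub _ hz
  simp only at this
  omega

theorem FillsBox.single (y z : ℤ) : FillsBox y y z z {(y, z)} := by
  constructor <;> simp

theorem FillsBox.insert_down {y₀ y₁ z₀ z₁ z : ℤ} {M : Finset (ℤ × ℤ)}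
    (h : FillsBox y₀ y₁ z₀ z₁ M) (hm : (y₁, z) ∈ M) :
    FillsBox y₀ (y₁ + 1) z₀ z₁ (insert (y₁ + 1, z) M) := by
  have h1 := h.sub
  have h2 := h.sub _ hm
  have h3 := h.le_rows
  constructor
  · intro c hc
    rcases Finset.mem_insert.1 hc with rfl | hc
    · simp only at *; omega
    · have := h1 c hc; omega
  · obtain ⟨a, ha⟩ := h.top; exact ⟨a, Finset.mem_insert_of_mem ha⟩
  · exact ⟨z, Finset.mem_insert_self _ _⟩
  · obtain ⟨a, ha⟩ := h.left; exact ⟨a, Finset.mem_insert_of_mem ha⟩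
  · obtain ⟨a, ha⟩ := h.right; exact ⟨a, Finset.mem_insert_of_mem ha⟩

theorem FillsBox.insert_up {y₀ y₁ z₀ z₁ z : ℤ} {M : Finset (ℤ × ℤ)}
    (h : FillsBox y₀ y₁ z₀ z₁ M) (hm : (y₀, z) ∈ M) :
    FillsBox (y₀ - 1) y₁ z₀ z₁ (insert (y₀ - 1, z) M) := by
  have h1 := h.sub
  have h2 := h.sub _ hm
  have h3 := h.le_rows
  constructor
  · intro c hc
    rcases Finset.mem_insert.1 hc with rfl | hc
    · simp only at *; omega
    · have := h1 c hc; omega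
  · exact ⟨z, Finset.mem_insert_self _ _⟩
  · obtain ⟨a, ha⟩ := h.bot; exact ⟨a, Finset.mem_insert_of_mem ha⟩
  · obtain ⟨a, ha⟩ := h.left; exact ⟨a, Finset.mem_insert_of_mem ha⟩
  · obtain ⟨a, ha⟩ := h.right; exact ⟨a, Finset.mem_insert_of_mem ha⟩

theorem FillsBox.insert_right {y₀ y₁ z₀ z₁ y : ℤ} {M : Finset (ℤ × ℤ)}
    (h : FillsBox y₀ y₁ z₀ z₁ M) (hm : (y, z₁) ∈ M) :
    FillsBox y₀ y₁ z₀ (z₁ + 1) (insert (y, z₁ + 1) M) := by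
  have h1 := h.sub
  have h2 := h.sub _ hm
  have h3 := h.le_cols
  constructor
  · intro c hc
    rcases Finset.mem_insert.1 hc with rfl | hc
    · simp only at *; omega
    · have := h1 c hc; omega
  · obtain ⟨a, ha⟩ := h.top; exact ⟨a, Finset.mem_insert_of_mem ha⟩
  · obtain ⟨a, ha⟩ := h.bot; exact ⟨a, Finset.mem_insert_of_mem ha⟩
  · obtain ⟨a, ha⟩ := h.left; exact ⟨a, Finset.mem_insert_of_mem ha⟩
  · exact ⟨y, Finset.mem_insert_self _ _⟩

theorem FillsBox.insert_left {y₀ y₁ z₀ z₁ y : ℤ} {M : Finset (ℤ × ℤ)}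
    (h : FillsBox y₀ y₁ z₀ z₁ M) (hm : (y, z₀) ∈ M) :
    FillsBox y₀ y₁ (z₀ - 1) z₁ (insert (y, z₀ - 1) M) := by
  have h1 := h.sub
  have h2 := h.sub _ hm
  have h3 := h.le_cols
  constructor
  · intro c hc
    rcases Finset.mem_insert.1 hc with rfl | hc
    · simp only at *; omega
    · have := h1 c hc; omega
  · obtain ⟨a, ha⟩ := h.top; exact ⟨a, Finset.mem_insert_of_mem ha⟩
  · obtain ⟨a, ha⟩ := h.bot; exact ⟨a, Finset.mem_insert_of_mem ha⟩
  · exact ⟨y, Finset.mem_insert_self _ _⟩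
  · obtain ⟨a, ha⟩ := h.right; exact ⟨a, Finset.mem_insert_of_mem ha⟩

theorem FillsBox.insert_inside {y₀ y₁ z₀ z₁ : ℤ} {c : ℤ × ℤ} {M : Finset (ℤ × ℤ)}
    (h : FillsBox y₀ y₁ z₀ z₁ M) (hc : y₀ ≤ c.1 ∧ c.1 ≤ y₁ ∧ z₀ ≤ c.2 ∧ c.2 ≤ z₁) :
    FillsBox y₀ y₁ z₀ z₁ (insert c M) := by
  constructor
  · intro d hd
    rcases Finset.mem_insert.1 hd with rfl | hd
    · exact hc
    · exact h.sub d hd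
  · obtain ⟨a, ha⟩ := h.top; exact ⟨a, Finset.mem_insert_of_mem ha⟩
  · obtain ⟨a, ha⟩ := h.bot; exact ⟨a, Finset.mem_insert_of_mem ha⟩
  · obtain ⟨a, ha⟩ := h.left; exact ⟨a, Finset.mem_insert_of_mem ha⟩
  · obtain ⟨a, ha⟩ := h.right; exact ⟨a, Finset.mem_insert_of_mem ha⟩

theorem FillsBox.unique {y₀ y₁ z₀ z₁ y₀' y₁' z₀' z₁' : ℤ} {M : Finset (ℤ × ℤ)}
    (h : FillsBox y₀ y₁ z₀ z₁ M) (h' : FillsBox y₀' y₁' z₀' z₁' M) :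
    y₀ = y₀' ∧ y₁ = y₁' ∧ z₀ = z₀' ∧ z₁ = z₁' := by
  obtain ⟨a, ha⟩ := h.top
  obtain ⟨b, hb⟩ := h.bot
  obtain ⟨c, hc⟩ := h.left
  obtain ⟨d, hd⟩ := h.right
  obtain ⟨a', ha'⟩ := h'.top
  obtain ⟨b', hb'⟩ := h'.bot
  obtain ⟨c', hc'⟩ := h'.left
  obtain ⟨d', hd'⟩ := h'.right
  have h1 := h'.sub _ ha
  have h2 := h'.sub _ hb
  have h3 := h'.sub _ hc
  have h4 := h'.sub _ hd
  have h5 := h.sub _ ha'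
  have h6 := h.sub _ hb'
  have h7 := h.sub _ hc'
  have h8 := h.sub _ hd'
  simp only at *
  omega

theorem Slim.fillsBox {y₀ y₁ z₀ z₁ : ℤ} {M : Finset (ℤ × ℤ)} (h : Slim y₀ y₁ z₀ z₁ M) :
    FillsBox y₀ y₁ z₀ z₁ M := by
  induction h with
  | single y z => exact FillsBox.single y z
  | down _ hm ih => exact ih.insert_down hm
  | up _ hm ih => exact ih.insert_up hm
  | right _ hm ih => exact ih.insert_right hm
  | left _ hm ih => exact ih.insert_left hm

/-- Induction for slim sets in which the four kinds of steps are treated alike: the new cell has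
exactly one neighbour in the old set. -/
theorem Slim.leaf_induction {motive : Finset (ℤ × ℤ) → Prop}
    (single : ∀ c, motive {c})
    (step : ∀ (M : Finset (ℤ × ℤ)) (u x : ℤ × ℤ), motive M → u ∈ M → x ∉ M →
      (∀ q ∈ M, GridAdj x q ↔ q = u) → motive (insert x M))
    {y₀ y₁ z₀ z₁ : ℤ} {M : Finset (ℤ × ℤ)} (h : Slim y₀ y₁ z₀ z₁ M) : motive M := by
  induction h with
  | single y z => exact single _
  | down h hm ih =>
    refine step _ _ _ ih hm (fun hx => ?_) (fun q hq => ?_)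
    · have := h.fillsBox.sub _ hx; simp only at this; omega
    · have := h.fillsBox.sub _ hq
      rw [Prod.ext_iff]; simp only [GridAdj]; omega
  | up h hm ih =>
    refine step _ _ _ ih hm (fun hx => ?_) (fun q hq => ?_)
    · have := h.fillsBox.sub _ hx; simp only at this; omega
    · have := h.fillsBox.sub _ hq
      rw [Prod.ext_iff]; simp only [GridAdj]; omega
  | right h hm ih =>
    refine step _ _ _ ih hm (fun hx => ?_) (fun q hq => ?_)
    · have := h.fillsBox.sub _ hx; simp only at this; omega
    · have := h.fillsBox.sub _ hq
      rw [Prod.ext_iff]; simp only [GridAdj]; omega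
  | left h hm ih =>
    refine step _ _ _ ih hm (fun hx => ?_) (fun q hq => ?_)
    · have := h.fillsBox.sub _ hx; simp only at this; omega
    · have := h.fillsBox.sub _ hq
      rw [Prod.ext_iff]; simp only [GridAdj]; omega

theorem Slim.card_eq {y₀ y₁ z₀ z₁ : ℤ} {M : Finset (ℤ × ℤ)} (h : Slim y₀ y₁ z₀ z₁ M) :
    (M.card : ℤ) = (y₁ - y₀) + (z₁ - z₀) + 1 := by
  induction h with
  | single y z => simp
  | down h hm ih =>
    rw [Finset.card_insert_of_notMem fun hx => by
      have := h.fillsBox.sub _ hx; simp only at this; omega]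
    push_cast; omega
  | up h hm ih =>
    rw [Finset.card_insert_of_notMem fun hx => by
      have := h.fillsBox.sub _ hx; simp only at this; omega]
    push_cast; omega
  | right h hm ih =>
    rw [Finset.card_insert_of_notMem fun hx => by
      have := h.fillsBox.sub _ hx; simp only at this; omega]
    push_cast; omega
  | left h hm ih =>
    rw [Finset.card_insert_of_notMem fun hx => by
      have := h.fillsBox.sub _ hx; simp only at this; omega]
    push_cast; omega

/-- A vertical step creates no edge between columns, and a horizontal step creates one that is the
first between the old outer column and the new one. This uniqueness later shows that each edge of a
projection is realised in a layer of the polyomino. -/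
theorem Slim.col_edge_unique {y₀ y₁ z₀ z₁ : ℤ} {M : Finset (ℤ × ℤ)} (h : Slim y₀ y₁ z₀ z₁ M)
    {y y' z : ℤ} (h1 : (y, z) ∈ M) (h2 : (y, z + 1) ∈ M) (h3 : (y', z) ∈ M)
    (h4 : (y', z + 1) ∈ M) : y = y' := by
  induction h with
  | single a b => simp at *; omega
  | down h hm ih =>
    have hs := h.fillsBox.sub
    have a1 := fun a b hx => hs (a, b) hx
    simp only [Finset.mem_insert, Prod.mk.injEq] at h1 h2 h3 h4
    grind
  | up h hm ih =>
    have hs := h.fillsBox.sub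
    have a1 := fun a b hx => hs (a, b) hx
    simp only [Finset.mem_insert, Prod.mk.injEq] at h1 h2 h3 h4
    grind
  | right h hm ih =>
    have hs := h.fillsBox.sub
    have a1 := fun a b hx => hs (a, b) hx
    simp only [Finset.mem_insert, Prod.mk.injEq] at h1 h2 h3 h4
    grind
  | left h hm ih =>
    have hs := h.fillsBox.sub
    have a1 := fun a b hx => hs (a, b) hx
    simp only [Finset.mem_insert, Prod.mk.injEq] at h1 h2 h3 h4
    grind

theorem Slim.row_edge_unique {y₀ y₁ z₀ z₁ : ℤ} {M : Finset (ℤ × ℤ)} (h : Slim y₀ y₁ z₀ z₁ M)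
    {y z z' : ℤ} (h1 : (y, z) ∈ M) (h2 : (y + 1, z) ∈ M) (h3 : (y, z') ∈ M)
    (h4 : (y + 1, z') ∈ M) : z = z' := by
  induction h with
  | single a b => simp at *; omega
  | down h hm ih =>
    have hs := h.fillsBox.sub
    have a1 := fun a b hx => hs (a, b) hx
    simp only [Finset.mem_insert, Prod.mk.injEq] at h1 h2 h3 h4
    grind
  | up h hm ih =>
    have hs := h.fillsBox.sub
    have a1 := fun a b hx => hs (a, b) hx
    simp only [Finset.mem_insert, Prod.mk.injEq] at h1 h2 h3 h4
    grind
  | right h hm ih =>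
    have hs := h.fillsBox.sub
    have a1 := fun a b hx => hs (a, b) hx
    simp only [Finset.mem_insert, Prod.mk.injEq] at h1 h2 h3 h4
    grind
  | left h hm ih =>
    have hs := h.fillsBox.sub
    have a1 := fun a b hx => hs (a, b) hx
    simp only [Finset.mem_insert, Prod.mk.injEq] at h1 h2 h3 h4
    grind

/-- Together with uniqueness, this makes the edge between two consecutive columns a function of the
column, which is how crosses are recognised. -/
theorem Slim.exists_col_edge {y₀ y₁ z₀ z₁ : ℤ} {M : Finset (ℤ × ℤ)} (h : Slim y₀ y₁ z₀ z₁ M)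
    {z : ℤ} (h0 : z₀ ≤ z) (h1 : z < z₁) : ∃ y, (y, z) ∈ M ∧ (y, z + 1) ∈ M := by
  induction h with
  | single a b => omega
  | down h hm ih => grind
  | up h hm ih => grind
  | right h hm ih => grind
  | left h hm ih => grind

theorem Slim.exists_row_edge {y₀ y₁ z₀ z₁ : ℤ} {M : Finset (ℤ × ℤ)} (h : Slim y₀ y₁ z₀ z₁ M)
    {y : ℤ} (h0 : y₀ ≤ y) (h1 : y < y₁) : ∃ z, (y, z) ∈ M ∧ (y + 1, z) ∈ M := by
  induction h with
  | single a b => omega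
  | down h hm ih => grind
  | up h hm ih => grind
  | right h hm ih => grind
  | left h hm ih => grind

/-! ### Connectedness and the lower bound for planar sets -/

/-- Connectedness of a finite set under a relation: no proper nonempty part is closed under
taking neighbours. -/
def FinConn {α : Type*} (r : α → α → Prop) (M : Finset α) : Prop :=
  M.Nonempty ∧ ∀ S : Set α, (∃ a ∈ M, a ∈ S) → (∀ a ∈ M, ∀ b ∈ M, a ∈ S → r a b → b ∈ S) →
    ∀ a ∈ M, a ∈ S

/-- Closed parts pass through projections and one-cell extensions more easily than walks in an
induced graph; this is the only place where walks are used. -/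
theorem finConn_iff_connected_induce {α : Type*} (G : SimpleGraph α) (M : Finset α) :
    FinConn G.Adj M ↔ (G.induce (M : Set α)).Connected := by
  constructor
  · rintro ⟨⟨a, ha⟩, h⟩
    have : Nonempty (M : Set α) := ⟨⟨a, ha⟩⟩
    refine ⟨fun u v => ?_⟩
    have := h {w | ∃ hw : w ∈ M, (G.induce (M : Set α)).Reachable u ⟨w, hw⟩}
      ⟨u, u.2, u.2, SimpleGraph.Reachable.refl _⟩ ?_ v v.2
    · obtain ⟨_, h⟩ := this
      exact h
    · rintro a ha b hb ⟨_, hr⟩ hab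
      refine ⟨hb, hr.trans (SimpleGraph.Adj.reachable ?_)⟩
      simpa using hab
  · intro h
    obtain ⟨a⟩ := h.nonempty
    refine ⟨⟨a, a.2⟩, fun S ⟨s, hsM, hsS⟩ hcl b hb => ?_⟩
    obtain ⟨w⟩ := h.preconnected ⟨s, hsM⟩ ⟨b, hb⟩
    have key : ∀ {u v : (M : Set α)}, (G.induce (M : Set α)).Walk u v → u.1 ∈ S → v.1 ∈ S := by
      intro u v w
      induction w with
      | nil => exact id
      | cons hadj _ ih =>
        intro hu
        exact ih (hcl _ (Subtype.prop _) _ (Subtype.prop _) hu (by simpa using hadj))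
    exact key w hsS

theorem Slim.finConn {y₀ y₁ z₀ z₁ : ℤ} {M : Finset (ℤ × ℤ)} (h : Slim y₀ y₁ z₀ z₁ M) :
    FinConn GridAdj M := by
  refine h.leaf_induction (motive := FinConn GridAdj) (fun c => ?_) ?_
  · refine ⟨⟨c, by simp⟩, fun S ⟨a, ha, haS⟩ _ b hb => ?_⟩
    simp only [Finset.mem_singleton] at ha hb
    rw [hb, ← ha]; exact haS
  · intro M u x ⟨_, ih⟩ hu hx hadj
    have hxu : GridAdj x u := (hadj u hu).2 rfl
    refine ⟨⟨u, Finset.mem_insert_of_mem hu⟩, fun S ⟨a, ha, haS⟩ hcl => ?_⟩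
    have hM : ∀ a ∈ M, a ∈ S := by
      refine ih S ?_ fun a ha b hb => hcl a (Finset.mem_insert_of_mem ha) b
        (Finset.mem_insert_of_mem hb)
      rcases Finset.mem_insert.1 ha with rfl | ha
      · exact ⟨u, hu, hcl _ ha u (Finset.mem_insert_of_mem hu) haS hxu⟩
      · exact ⟨a, ha, haS⟩
    intro b hb
    rcases Finset.mem_insert.1 hb with rfl | hb
    · exact hcl u (Finset.mem_insert_of_mem hu) _ hb (hM u hu) hxu.symm
    · exact hM b hb

theorem FinConn.exists_adj_notMem {α : Type*} {r : α → α → Prop} {M S : Finset α}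
    (h : FinConn r M) (hS : S.Nonempty) (hSM : S ⊆ M) (hne : S ≠ M) :
    ∃ u ∈ S, ∃ x ∈ M, x ∉ S ∧ r u x := by
  by_contra! hcon
  obtain ⟨s, hs⟩ := hS
  refine hne (hSM.antisymm (h.2 (S : Set α) ⟨s, hSM hs, hs⟩ fun a _ b hb haS hab => ?_))
  by_contra hbS
  exact hcon a haS b hb hbS hab

/-- Every connected set has at least `rows + columns - 1` cells, and is slim if it has no more. -/
theorem FinConn.exists_box {M : Finset (ℤ × ℤ)} (h : FinConn GridAdj M) :
    ∃ y₀ y₁ z₀ z₁, FillsBox y₀ y₁ z₀ z₁ M ∧ (y₁ - y₀) + (z₁ - z₀) + 1 ≤ (M.card : ℤ) ∧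
      ((y₁ - y₀) + (z₁ - z₀) + 1 = (M.card : ℤ) → Slim y₀ y₁ z₀ z₁ M) := by
  classical
  let Q : Finset (ℤ × ℤ) → Prop := fun S =>
    ∃ y₀ y₁ z₀ z₁, FillsBox y₀ y₁ z₀ z₁ S ∧ (y₁ - y₀) + (z₁ - z₀) + 1 ≤ (S.card : ℤ) ∧
      ((y₁ - y₀) + (z₁ - z₀) + 1 = (S.card : ℤ) → Slim y₀ y₁ z₀ z₁ S)
  obtain ⟨a, ha⟩ := h.1
  -- A largest subset of M satisfying the claim must be M, since otherwise a neighbouring cell could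
  -- be added to it.
  obtain ⟨S, hS, hmax⟩ := (M.powerset.filter Q).exists_max_image Finset.card
    ⟨{a}, by
      simp only [Finset.mem_filter, Finset.mem_powerset, Finset.singleton_subset_iff]
      exact ⟨ha, a.1, a.1, a.2, a.2, FillsBox.single _ _, by simp, fun _ => Slim.single _ _⟩⟩
  simp only [Finset.mem_filter, Finset.mem_powerset] at hS hmax
  obtain ⟨hSM, y₀, y₁, z₀, z₁, hbox, hle, hslim⟩ := hS
  by_cases hne : S = M
  · subst hne; exact ⟨y₀, y₁, z₀, z₁, hbox, hle, hslim⟩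
  exfalso
  obtain ⟨z, hz⟩ := hbox.top
  obtain ⟨u, hu, x, hxM, hxS, hux⟩ := h.exists_adj_notMem ⟨_, hz⟩ hSM hne
  have hcard : ((insert x S).card : ℤ) = S.card + 1 := by
    rw [Finset.card_insert_of_notMem hxS]; simp
  suffices Q (insert x S) by
    have := hmax _ ⟨Finset.insert_subset hxM hSM, this⟩
    rw [Finset.card_insert_of_notMem hxS] at this
    omega
  have hub := hbox.sub u hu
  by_cases hin : y₀ ≤ x.1 ∧ x.1 ≤ y₁ ∧ z₀ ≤ x.2 ∧ x.2 ≤ z₁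
  -- A cell added inside the box is surplus: the inequality becomes strict and the slimness clause
  -- is vacuous.
  · exact ⟨y₀, y₁, z₀, z₁, hbox.insert_inside hin, by omega, fun _ => by omega⟩
  obtain ⟨u1, u2⟩ := u
  obtain ⟨x1, x2⟩ := x
  simp only [GridAdj] at *
  have hcases : (x1 = y₁ + 1 ∧ x2 = u2 ∧ u1 = y₁) ∨ (x1 = y₀ - 1 ∧ x2 = u2 ∧ u1 = y₀) ∨
      (x2 = z₁ + 1 ∧ x1 = u1 ∧ u2 = z₁) ∨ (x2 = z₀ - 1 ∧ x1 = u1 ∧ u2 = z₀) := by omega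
  rcases hcases with ⟨rfl, rfl, rfl⟩ | ⟨rfl, rfl, rfl⟩ | ⟨rfl, rfl, rfl⟩ | ⟨rfl, rfl, rfl⟩
  · exact ⟨_, _, _, _, hbox.insert_down hu, by omega, fun _ => (hslim (by omega)).down hu⟩
  · exact ⟨_, _, _, _, hbox.insert_up hu, by omega, fun _ => (hslim (by omega)).up hu⟩
  · exact ⟨_, _, _, _, hbox.insert_right hu, by omega, fun _ => (hslim (by omega)).right hu⟩
  · exact ⟨_, _, _, _, hbox.insert_left hu, by omega, fun _ => (hslim (by omega)).left hu⟩

/-! ### Degree weights under attaching a leaf -/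

/-- The number of neighbours of `v` in `M`. -/
def gridDeg (M : Finset (ℤ × ℤ)) (v : ℤ × ℤ) : ℕ := (M.filter (GridAdj v)).card

/-- The sum of `2 ^ degree` over the cells of `M`. -/
def degWeight (M : Finset (ℤ × ℤ)) : ℕ := ∑ v ∈ M, 2 ^ gridDeg M v

theorem not_gridAdj_self (v : ℤ × ℤ) : ¬ GridAdj v v := by unfold GridAdj; omega

theorem gridDeg_insert {M : Finset (ℤ × ℤ)} {u x : ℤ × ℤ} (hx : x ∉ M)
    (hadj : ∀ q ∈ M, GridAdj x q ↔ q = u) {v : ℤ × ℤ} (hv : v ∈ M) :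
    gridDeg (insert x M) v = gridDeg M v + if v = u then 1 else 0 := by
  unfold gridDeg
  have hiff : GridAdj v x ↔ v = u := ⟨fun h => (hadj v hv).1 h.symm, fun h => ((hadj v hv).2 h).symm⟩
  rw [Finset.filter_insert]
  by_cases h : v = u
  · rw [if_pos (hiff.2 h), if_pos h, Finset.card_insert_of_notMem (by simp [hx])]
  · rw [if_neg (fun h' => h (hiff.1 h')), if_neg h, add_zero]

theorem gridDeg_insert_self {M : Finset (ℤ × ℤ)} {u x : ℤ × ℤ} (hu : u ∈ M)
    (hadj : ∀ q ∈ M, GridAdj x q ↔ q = u) : gridDeg (insert x M) x = 1 := by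
  unfold gridDeg
  rw [Finset.filter_insert, if_neg (not_gridAdj_self x), Finset.card_eq_one]
  refine ⟨u, ?_⟩
  ext q
  simp only [Finset.mem_filter, Finset.mem_singleton]
  exact ⟨fun h => (hadj q h.1).1 h.2, fun h => h ▸ ⟨hu, (hadj u hu).2 rfl⟩⟩

theorem gridDeg_singleton (c : ℤ × ℤ) : gridDeg {c} c = 0 := by
  simp [gridDeg, Finset.filter_singleton, not_gridAdj_self]

theorem degWeight_singleton (c : ℤ × ℤ) : degWeight {c} = 1 := by
  simp [degWeight, gridDeg_singleton]

/-- The term of u doubles because its degree grows by one, and the new leaf contributes 2 ^ 1. -/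
theorem degWeight_insert {M : Finset (ℤ × ℤ)} {u x : ℤ × ℤ} (hu : u ∈ M) (hx : x ∉ M)
    (hadj : ∀ q ∈ M, GridAdj x q ↔ q = u) :
    degWeight (insert x M) = degWeight M + 2 ^ gridDeg M u + 2 := by
  unfold degWeight
  rw [Finset.sum_insert hx, gridDeg_insert_self hu hadj, ← Finset.add_sum_erase M _ hu,
    ← Finset.add_sum_erase M _ hu, gridDeg_insert hx hadj hu, if_pos rfl, pow_succ]
  have : ∑ v ∈ M.erase u, 2 ^ gridDeg (insert x M) v = ∑ v ∈ M.erase u, 2 ^ gridDeg M v := by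
    refine Finset.sum_congr rfl fun v hv => ?_
    rw [gridDeg_insert hx hadj (Finset.mem_of_mem_erase hv), if_neg (Finset.ne_of_mem_erase hv),
      add_zero]
  rw [this]
  ring

/-! ### Counting layerings of a planar tree -/

/-- `P` consists of cells in the layers `0` and `1` above the cells of `M`; both layers are present
exactly above the cells of `D`, and each adjacency of `M` is realised in one of the layers. -/
structure IsLayering (D M : Finset (ℤ × ℤ)) (P : Finset Cell) : Prop where
  sub : ∀ c ∈ P, (c.1 = 0 ∨ c.1 = 1) ∧ c.2 ∈ M
  cover : ∀ p ∈ M, ((0, p) : Cell) ∈ P ∨ ((1, p) : Cell) ∈ P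
  double : ∀ p ∈ M, (((0, p) : Cell) ∈ P ∧ ((1, p) : Cell) ∈ P) ↔ p ∈ D
  adj : ∀ p ∈ M, ∀ q ∈ M, GridAdj p q → ∃ x : ℤ, ((x, p) : Cell) ∈ P ∧ ((x, q) : Cell) ∈ P

open Classical in
/-- The finite set of all layerings of `M` with doubled cells `D`. -/
noncomputable def layerings (D M : Finset (ℤ × ℤ)) : Finset (Finset Cell) :=
  ((({0, 1} : Finset ℤ) ×ˢ M).powerset).filter (IsLayering D M)

theorem mem_layerings {D M : Finset (ℤ × ℤ)} {P : Finset Cell} :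
    P ∈ layerings D M ↔ IsLayering D M P := by
  simp only [layerings, Finset.mem_filter, Finset.mem_powerset, and_iff_right_iff_imp]
  intro h c hc
  have := h.sub c hc
  simp [Finset.mem_product, this]

open Classical in
/-- The possible sets of layers above a new cell `x` extending a layering `P` of `M`. -/
noncomputable def newLayers (D M : Finset (ℤ × ℤ)) (x : ℤ × ℤ) (P : Finset Cell) :
    Finset (Finset ℤ) :=
  ({0, 1} : Finset ℤ).powerset.filter fun T => (0 ∈ T ∨ 1 ∈ T) ∧ (0 ∈ T ∧ 1 ∈ T ↔ x ∈ D) ∧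
    ∀ q ∈ M, GridAdj x q → ∃ e ∈ T, ((e, q) : Cell) ∈ P

theorem IsLayering.extend {D M : Finset (ℤ × ℤ)} {x : ℤ × ℤ} {P : Finset Cell} {T : Finset ℤ}
    (hx : x ∉ M) (hP : IsLayering D M P) (hT : T ∈ newLayers D M x P) :
    IsLayering D (insert x M) (P ∪ T.image fun e => ((e, x) : Cell)) := by
  simp only [newLayers, Finset.mem_filter, Finset.mem_powerset] at hT
  obtain ⟨hT0, hT1, hT2, hT3⟩ := hT
  have hPx : ∀ e : ℤ, ((e, x) : Cell) ∉ P := fun e he => hx (hP.sub _ he).2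
  have memx : ∀ e : ℤ, ((e, x) : Cell) ∈ P ∪ T.image (fun e => ((e, x) : Cell)) ↔ e ∈ T := by
    intro e; simp [hPx]
  have memM : ∀ (e : ℤ), ∀ q ∈ M,
      (((e, q) : Cell) ∈ P ∪ T.image (fun e => ((e, x) : Cell)) ↔ ((e, q) : Cell) ∈ P) := by
    intro e q hq
    simp only [Finset.mem_union, Finset.mem_image, Prod.mk.injEq, or_iff_left_iff_imp]
    rintro ⟨_, _, _, rfl⟩
    exact absurd hq hx
  refine ⟨fun c hc => ?_, fun p hp => ?_, fun p hp => ?_, fun p hp q hq hpq => ?_⟩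
  · rcases Finset.mem_union.1 hc with hc | hc
    · exact ⟨(hP.sub c hc).1, Finset.mem_insert_of_mem (hP.sub c hc).2⟩
    · obtain ⟨e, he, rfl⟩ := Finset.mem_image.1 hc
      have := hT0 he
      simp at this
      exact ⟨this, Finset.mem_insert_self _ _⟩
  · rcases Finset.mem_insert.1 hp with rfl | hp
    · rw [memx, memx]; exact hT1
    · rw [memM _ _ hp, memM _ _ hp]; exact hP.cover p hp
  · rcases Finset.mem_insert.1 hp with rfl | hp
    · rw [memx, memx]; exact hT2
    · rw [memM _ _ hp, memM _ _ hp]; exact hP.double p hp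
  · rcases Finset.mem_insert.1 hp with rfl | hpM <;> rcases Finset.mem_insert.1 hq with rfl | hqM
    · exact absurd hpq (not_gridAdj_self _)
    · obtain ⟨e, he, h⟩ := hT3 q hqM hpq
      exact ⟨e, (memx e).2 he, (memM _ _ hqM).2 h⟩
    · obtain ⟨e, he, h⟩ := hT3 p hpM hpq.symm
      exact ⟨e, (memM _ _ hpM).2 h, (memx e).2 he⟩
    · obtain ⟨e, h1, h2⟩ := hP.adj p hpM q hqM hpq
      exact ⟨e, (memM _ _ hpM).2 h1, (memM _ _ hqM).2 h2⟩

theorem IsLayering.restrict {D M : Finset (ℤ × ℤ)} {x : ℤ × ℤ} {P : Finset Cell}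
    (hx : x ∉ M) (hP : IsLayering D (insert x M) P) :
    IsLayering D M (P.filter fun c => c.2 ≠ x) := by
  have hne : ∀ p ∈ M, p ≠ x := fun p hp h => hx (h ▸ hp)
  refine ⟨fun c hc => ?_, fun p hp => ?_, fun p hp => ?_, fun p hp q hq hpq => ?_⟩
  · have := Finset.mem_filter.1 hc
    exact ⟨(hP.sub c this.1).1, (Finset.mem_insert.1 (hP.sub c this.1).2).resolve_left this.2⟩
  · simpa [hne p hp] using hP.cover p (Finset.mem_insert_of_mem hp)
  · simpa [hne p hp] using hP.double p (Finset.mem_insert_of_mem hp)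
  · simpa [hne p hp, hne q hq] using
      hP.adj p (Finset.mem_insert_of_mem hp) q (Finset.mem_insert_of_mem hq) hpq

theorem IsLayering.newLayers_mem {D M : Finset (ℤ × ℤ)} {x : ℤ × ℤ} {P : Finset Cell}
    (hx : x ∉ M) (hP : IsLayering D (insert x M) P) :
    (({0, 1} : Finset ℤ).filter fun e => ((e, x) : Cell) ∈ P) ∈
      newLayers D M x (P.filter fun c => c.2 ≠ x) := by
  have hxm := Finset.mem_insert_self x M
  simp only [newLayers, Finset.mem_filter, Finset.mem_powerset]
  refine ⟨Finset.filter_subset _ _, by simpa using hP.cover x hxm, by simpa using hP.double x hxm,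
    fun q hq hxq => ?_⟩
  obtain ⟨e, h1, h2⟩ := hP.adj x hxm q (Finset.mem_insert_of_mem hq) hxq
  have := (hP.sub _ h1).1
  exact ⟨e, ⟨by simpa using this, h1⟩, h2, fun h => hx (h ▸ hq)⟩

/-- Cutting a layering into its part over M and the set of layers used above x is a bijection. -/
theorem card_layerings_insert {D M : Finset (ℤ × ℤ)} {x : ℤ × ℤ} (hx : x ∉ M) :
    (layerings D (insert x M)).card = ∑ P ∈ layerings D M, (newLayers D M x P).card := by
  rw [← Finset.card_sigma]
  refine Finset.card_bij'
    (fun P _ => (⟨P.filter fun c => c.2 ≠ x,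
      ({0, 1} : Finset ℤ).filter fun e => ((e, x) : Cell) ∈ P⟩ : (_ : Finset Cell) × Finset ℤ))
    (fun a _ => a.1 ∪ a.2.image fun e => ((e, x) : Cell)) ?_ ?_ ?_ ?_
  · intro P hP
    rw [mem_layerings] at hP
    exact Finset.mem_sigma.2 ⟨mem_layerings.2 (hP.restrict hx), hP.newLayers_mem hx⟩
  · rintro ⟨P, T⟩ h
    rw [Finset.mem_sigma, mem_layerings] at h
    exact mem_layerings.2 (h.1.extend hx h.2)
  · intro P hP
    rw [mem_layerings] at hP
    ext ⟨e, q⟩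
    simp only [Finset.mem_union, Finset.mem_filter, Finset.mem_image, Finset.mem_insert,
      Finset.mem_singleton, Prod.mk.injEq]
    constructor
    · rintro (h | ⟨a, ⟨_, h⟩, rfl, rfl⟩)
      · exact h.1
      · exact h
    · intro h
      by_cases hq : q = x
      · subst hq
        exact Or.inr ⟨e, ⟨(hP.sub _ h).1, h⟩, rfl, rfl⟩
      · exact Or.inl ⟨h, hq⟩
  · rintro ⟨P, T⟩ h
    rw [Finset.mem_sigma, mem_layerings] at h
    obtain ⟨hP, hT⟩ := h
    simp only [newLayers, Finset.mem_filter, Finset.mem_powerset] at hT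
    have hPx : ∀ e : ℤ, ((e, x) : Cell) ∉ P := fun e he => hx (hP.sub _ he).2
    congr 1
    · ext ⟨e, q⟩
      simp only [Finset.mem_union, Finset.mem_filter, Finset.mem_image, Prod.mk.injEq]
      constructor
      · rintro ⟨h | ⟨_, _, _, rfl⟩, hq⟩
        · exact h
        · exact absurd rfl hq
      · intro h
        exact ⟨Or.inl h, fun hq => hPx e (by rw [← hq]; exact h)⟩
    · ext e
      simp only [Finset.mem_union, Finset.mem_filter, Finset.mem_image, Prod.mk.injEq, hPx,
        false_or, and_true, exists_eq_right, and_iff_right_iff_imp]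
      exact fun he => hT.1 he

theorem powerset_zero_one : ({0, 1} : Finset ℤ).powerset = {∅, {0}, {1}, {0, 1}} := by decide

theorem card_layerings_singleton {D : Finset (ℤ × ℤ)} {c : ℤ × ℤ} (hc : c ∉ D) :
    (layerings D {c}).card = 2 := by
  have h0 : layerings D ∅ = {∅} := by
    ext P
    rw [mem_layerings, Finset.mem_singleton]
    constructor
    · intro h
      refine Finset.eq_empty_of_forall_notMem fun c hc => ?_
      simpa using (h.sub c hc).2
    · rintro rfl
      constructor <;> simp
  have := card_layerings_insert (D := D) (M := ∅) (x := c) (by simp)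
  rw [h0, Finset.sum_singleton, insert_empty_eq] at this
  rw [this, newLayers, powerset_zero_one]
  simp [Finset.filter_insert, Finset.filter_singleton, hc]

theorem card_layerings_singleton' (c : ℤ × ℤ) : (layerings {c} {c}).card = 1 := by
  have h0 : layerings {c} ∅ = {∅} := by
    ext P
    rw [mem_layerings, Finset.mem_singleton]
    constructor
    · intro h
      refine Finset.eq_empty_of_forall_notMem fun c hc => ?_
      simpa using (h.sub c hc).2
    · rintro rfl
      constructor <;> simp
  have := card_layerings_insert (D := {c}) (M := ∅) (x := c) (by simp)
  rw [h0, Finset.sum_singleton, insert_empty_eq] at this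
  rw [this, newLayers, powerset_zero_one]
  simp [Finset.filter_insert, Finset.filter_singleton]

/-- The leaf x must share a layer with u. If x is doubled, its layers are determined; if x is
single, it has a free choice when u is doubled and must follow the layer of u otherwise. -/
theorem card_newLayers {D M : Finset (ℤ × ℤ)} {u x : ℤ × ℤ} {P : Finset Cell} (hu : u ∈ M)
    (hadj : ∀ q ∈ M, GridAdj x q ↔ q = u) (hP : IsLayering D M P) :
    (newLayers D M x P).card = if u ∈ D ∧ x ∉ D then 2 else 1 := by
  have hall : ∀ T : Finset ℤ, (∀ q ∈ M, GridAdj x q → ∃ e ∈ T, ((e, q) : Cell) ∈ P) ↔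
      ∃ e ∈ T, ((e, u) : Cell) ∈ P := fun T =>
    ⟨fun h => h u hu ((hadj u hu).2 rfl), fun h q hq hxq => by rwa [(hadj q hq).1 hxq]⟩
  have h1 := hP.cover u hu
  have h2 := hP.double u hu
  simp only [newLayers, hall, powerset_zero_one]
  by_cases hx : x ∈ D <;> by_cases a : ((0, u) : Cell) ∈ P <;> by_cases b : ((1, u) : Cell) ∈ P
  all_goals first
    | exact absurd h1 (not_or.2 ⟨a, b⟩)
    | simp [Finset.filter_insert, Finset.filter_singleton, hx, a, b, ← h2]

theorem card_layerings_leaf {D M : Finset (ℤ × ℤ)} {u x : ℤ × ℤ} (hu : u ∈ M) (hx : x ∉ M)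
    (hadj : ∀ q ∈ M, GridAdj x q ↔ q = u) :
    (layerings D (insert x M)).card =
      (layerings D M).card * if u ∈ D ∧ x ∉ D then 2 else 1 := by
  rw [card_layerings_insert hx, Finset.sum_congr rfl fun P hP =>
    card_newLayers hu hadj (mem_layerings.1 hP), Finset.sum_const, smul_eq_mul]

theorem layerings_congr {D D' M : Finset (ℤ × ℤ)} (h : ∀ p ∈ M, p ∈ D ↔ p ∈ D') :
    layerings D M = layerings D' M := by
  ext P
  rw [mem_layerings, mem_layerings]
  exact ⟨fun hP => ⟨hP.sub, hP.cover, fun p hp => (hP.double p hp).trans (h p hp), hP.adj⟩,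
    fun hP => ⟨hP.sub, hP.cover, fun p hp => (hP.double p hp).trans (h p hp).symm, hP.adj⟩⟩

/-- In a tree without doubled cells everything lies in one layer; a doubled cell v decouples the
branches at v, each of which picks its layer. The undoubled count is needed in the induction when
the doubled cell is the new leaf. -/
theorem Slim.card_layerings {y₀ y₁ z₀ z₁ : ℤ} {M : Finset (ℤ × ℤ)} (h : Slim y₀ y₁ z₀ z₁ M) :
    (layerings ∅ M).card = 2 ∧ ∀ v ∈ M, (layerings {v} M).card = 2 ^ gridDeg M v := by
  refine h.leaf_induction
    (motive := fun M => (layerings ∅ M).card = 2 ∧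
      ∀ v ∈ M, (layerings {v} M).card = 2 ^ gridDeg M v) (fun c => ?_) ?_
  · refine ⟨card_layerings_singleton (by simp), fun v hv => ?_⟩
    rw [Finset.mem_singleton.1 hv, card_layerings_singleton', gridDeg_singleton, pow_zero]
  · rintro M u x ⟨ih0, ih1⟩ hu hx hadj
    refine ⟨by rw [card_layerings_leaf hu hx hadj, ih0]; simp, fun v hv => ?_⟩
    rw [card_layerings_leaf hu hx hadj]
    rcases Finset.mem_insert.1 hv with rfl | hv
    · rw [gridDeg_insert_self hu hadj, layerings_congr (D' := ∅), ih0]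
      · simp
      · intro p hp
        simp only [Finset.mem_singleton, Finset.notMem_empty, iff_false]
        rintro rfl; exact hx hp
    · rw [ih1 v hv, gridDeg_insert hx hadj hv]
      have hxv : x ≠ v := fun h => hx (h ▸ hv)
      by_cases huv : v = u
      · subst huv; simp [hxv, pow_succ]
      · simp [huv, Ne.symm huv]

/-- All layerings of `M` with exactly one doubled cell. -/
noncomputable def lifts (M : Finset (ℤ × ℤ)) : Finset (Finset Cell) :=
  M.biUnion fun v => layerings {v} M

/-- The doubled cell can be read off from the layering, so the union over v is disjoint. -/
theorem Slim.card_lifts {y₀ y₁ z₀ z₁ : ℤ} {M : Finset (ℤ × ℤ)} (h : Slim y₀ y₁ z₀ z₁ M) :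
    (lifts M).card = degWeight M := by
  rw [lifts, Finset.card_biUnion, degWeight]
  · exact Finset.sum_congr rfl h.card_layerings.2
  · intro v hv w hw hvw
    rw [Function.onFun, Finset.disjoint_left]
    intro P hP hP'
    rw [mem_layerings] at hP hP'
    have := (hP'.double v hv).1 ((hP.double v hv).2 (Finset.mem_singleton_self v))
    exact hvw (Finset.mem_singleton.1 this)

/-! ### Minimal polyominoes as lifts of slim sets -/

theorem IsLayering.image_snd {D M : Finset (ℤ × ℤ)} {P : Finset Cell} (h : IsLayering D M P) :
    P.image Prod.snd = M := by
  ext p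
  rw [Finset.mem_image]
  constructor
  · rintro ⟨c, hc, rfl⟩; exact (h.sub c hc).2
  · intro hp
    rcases h.cover p hp with h | h
    · exact ⟨_, h, rfl⟩
    · exact ⟨_, h, rfl⟩

theorem card_two_layers {M : Finset (ℤ × ℤ)} {P : Finset Cell}
    (sub : ∀ c ∈ P, (c.1 = 0 ∨ c.1 = 1) ∧ c.2 ∈ M)
    (cover : ∀ p ∈ M, ((0, p) : Cell) ∈ P ∨ ((1, p) : Cell) ∈ P) :
    P.card = M.card + (M.filter fun p => ((0, p) : Cell) ∈ P ∧ ((1, p) : Cell) ∈ P).card := by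
  set A := M.filter fun p => ((0, p) : Cell) ∈ P with hA
  set B := M.filter fun p => ((1, p) : Cell) ∈ P with hB
  have h1 : A ∪ B = M := by
    rw [hA, hB, ← Finset.filter_or, Finset.filter_true_of_mem cover]
  have h2 : A ∩ B = M.filter fun p => ((0, p) : Cell) ∈ P ∧ ((1, p) : Cell) ∈ P := by
    rw [hA, hB, ← Finset.filter_and]
  have h3 : P = A.image (fun p => ((0, p) : Cell)) ∪ B.image (fun p => ((1, p) : Cell)) := by
    ext ⟨e, p⟩
    simp only [hA, hB, Finset.mem_union, Finset.mem_image, Finset.mem_filter, Prod.mk.injEq]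
    constructor
    · intro h
      obtain ⟨he | he, hp⟩ := sub _ h
      · simp only at he; subst he; exact Or.inl ⟨p, ⟨hp, h⟩, rfl, rfl⟩
      · simp only at he; subst he; exact Or.inr ⟨p, ⟨hp, h⟩, rfl, rfl⟩
    · rintro (⟨q, ⟨_, h⟩, rfl, rfl⟩ | ⟨q, ⟨_, h⟩, rfl, rfl⟩) <;> exact h
  rw [← h2, ← h1, Finset.card_union_add_card_inter]
  conv_lhs => rw [h3]
  rw [Finset.card_union_of_disjoint, Finset.card_image_of_injective,
    Finset.card_image_of_injective]
  · exact fun _ _ h => (Prod.mk.inj h).2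
  · exact fun _ _ h => (Prod.mk.inj h).2
  · rw [Finset.disjoint_left]
    intro c hc hc'
    obtain ⟨a, _, rfl⟩ := Finset.mem_image.1 hc
    obtain ⟨b, _, hb⟩ := Finset.mem_image.1 hc'
    simp at hb

theorem faceGraph_adj {c d : Cell} :
    faceGraph.Adj c d ↔ (c.1 = d.1 ∧ GridAdj c.2 d.2) ∨
      (c.2 = d.2 ∧ (c.1 = d.1 + 1 ∨ d.1 = c.1 + 1)) := by
  obtain ⟨a, b, c⟩ := c
  obtain ⟨a', b', c'⟩ := d
  simp only [faceGraph, GridAdj, Prod.mk.injEq]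
  grind

/-- Two cells above the same cell of M are adjacent, and every adjacency of M lifts to P, so a
closed part of P projects to a closed part of M and contains whole fibres. -/
theorem IsLayering.isPolyomino {M : Finset (ℤ × ℤ)} {v : ℤ × ℤ} {P : Finset Cell}
    (hM : FinConn GridAdj M) (hv : v ∈ M) (hP : IsLayering {v} M P) : IsPolyomino P := by
  rw [IsPolyomino, ← finConn_iff_connected_induce]
  have hv2 := (hP.double v hv).2 (Finset.mem_singleton_self v)
  refine ⟨⟨_, hv2.1⟩, fun S ⟨c, hc, hcS⟩ hcl => ?_⟩
  have hfib : ∀ p ∈ M, ∀ e e' : ℤ, ((e, p) : Cell) ∈ P → ((e', p) : Cell) ∈ P →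
      ((e, p) : Cell) ∈ S → ((e', p) : Cell) ∈ S := by
    intro p hp e e' he he' hS
    by_cases hee : e = e'
    · rwa [← hee]
    · refine hcl _ he _ he' hS (faceGraph_adj.2 (Or.inr ⟨rfl, ?_⟩))
      have h1 := (hP.sub _ he).1
      have h2 := (hP.sub _ he').1
      simp only at *
      omega
  have key := hM.2 {p | ∃ e : ℤ, ((e, p) : Cell) ∈ P ∧ ((e, p) : Cell) ∈ S}
    ⟨c.2, (hP.sub c hc).2, c.1, hc, hcS⟩ ?_
  · rintro ⟨e, p⟩ hep
    have hp := (hP.sub _ hep).2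
    obtain ⟨e', h1, h2⟩ := key p hp
    exact hfib p hp _ _ h1 hep h2
  · rintro a ha b hb ⟨e, h1, h2⟩ hab
    obtain ⟨e', h3, h4⟩ := hP.adj a ha b hb hab
    exact ⟨e', h4, hcl _ h3 _ h4 (hfib a ha _ _ h1 h3 h2) (faceGraph_adj.2 (Or.inl ⟨rfl, hab⟩))⟩

theorem IsLayering.card_eq {M : Finset (ℤ × ℤ)} {v : ℤ × ℤ} {P : Finset Cell}
    (hv : v ∈ M) (hP : IsLayering {v} M P) : P.card = M.card + 1 := by
  rw [card_two_layers hP.sub hP.cover, Finset.filter_congr hP.double]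
  simp only [Finset.mem_singleton, Finset.filter_eq', hv, if_true, Finset.card_singleton]

theorem IsLayering.isInscribed {M : Finset (ℤ × ℤ)} {v : ℤ × ℤ} {P : Finset Cell} {b k : ℕ}
    (hM : Slim 0 ((b : ℤ) - 1) 0 ((k : ℤ) - 1) M) (hv : v ∈ M) (hP : IsLayering {v} M P) :
    IsInscribed 2 b k P := by
  have hv2 := (hP.double v hv).2 (Finset.mem_singleton_self v)
  have hbox := hM.fillsBox
  have hlift : ∀ p ∈ M, ∃ c ∈ P, c.2 = p := fun p hp => by
    rcases hP.cover p hp with h | h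
    · exact ⟨_, h, rfl⟩
    · exact ⟨_, h, rfl⟩
  refine ⟨hP.isPolyomino hM.finConn hv, fun c hc => ?_, ⟨_, hv2.1, rfl⟩,
    ⟨_, hv2.2, by norm_num⟩, ?_, ?_, ?_, ?_⟩
  · have h1 := hP.sub c hc
    have h2 := hbox.sub _ h1.2
    push_cast
    omega
  · obtain ⟨z, hz⟩ := hbox.top
    obtain ⟨c, hc, h⟩ := hlift _ hz
    exact ⟨c, hc, by rw [h]⟩
  · obtain ⟨z, hz⟩ := hbox.bot
    obtain ⟨c, hc, h⟩ := hlift _ hz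
    exact ⟨c, hc, by rw [h]⟩
  · obtain ⟨z, hz⟩ := hbox.left
    obtain ⟨c, hc, h⟩ := hlift _ hz
    exact ⟨c, hc, by rw [h]⟩
  · obtain ⟨z, hz⟩ := hbox.right
    obtain ⟨c, hc, h⟩ := hlift _ hz
    exact ⟨c, hc, by rw [h]⟩

theorem finConn_image_snd {P : Finset Cell} (hP : IsPolyomino P) :
    FinConn GridAdj (P.image Prod.snd) := by
  rw [IsPolyomino, ← finConn_iff_connected_induce] at hP
  obtain ⟨hne, h⟩ := hP
  refine ⟨hne.image _, fun S ⟨a, ha, haS⟩ hcl b hb => ?_⟩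
  obtain ⟨c, hc, rfl⟩ := Finset.mem_image.1 ha
  obtain ⟨d, hd, rfl⟩ := Finset.mem_image.1 hb
  refine h (Prod.snd ⁻¹' S) ⟨c, hc, haS⟩ (fun e he f hf heS hef => ?_) d hd
  rcases faceGraph_adj.1 hef with ⟨_, h'⟩ | ⟨h', _⟩
  · exact hcl _ (Finset.mem_image_of_mem _ he) _ (Finset.mem_image_of_mem _ hf) heS h'
  · rw [Set.mem_preimage, ← h']; exact heS

/-- Used with f a coordinate: a discrete intermediate value property. -/
theorem IsPolyomino.exists_crossing {P : Finset Cell} (hP : IsPolyomino P) (f : Cell → ℤ) (n : ℤ)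
    (h0 : ∃ c ∈ P, f c ≤ n) (h1 : ∃ c ∈ P, n < f c) :
    ∃ c ∈ P, ∃ d ∈ P, f c ≤ n ∧ n < f d ∧ faceGraph.Adj c d := by
  rw [IsPolyomino, ← finConn_iff_connected_induce] at hP
  by_contra! hcon
  obtain ⟨d, hd, hd'⟩ := h1
  have := hP.2 {c | f c ≤ n} h0 (fun a ha b hb haS hab => by
    by_contra hbS
    exact hcon a ha b hb haS (not_le.1 hbS) hab) d hd
  simp only [Set.mem_ofPred_eq] at this
  omega

/-- A polyomino inscribed in a `2 × b × k` prism has at least `b + k` cells; if it has no more, it is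
a layering of a slim set with one doubled cell. -/
theorem IsInscribed.card_ge {b k : ℕ} {P : Finset Cell} (h : IsInscribed 2 b k P) :
    b + k ≤ P.card ∧ (P.card = b + k → ∃ M, Slim 0 ((b : ℤ) - 1) 0 ((k : ℤ) - 1) M ∧
      ∃ v ∈ M, IsLayering {v} M P) := by
  set M := P.image Prod.snd with hM
  have memM : ∀ p, p ∈ M ↔ ∃ e : ℤ, ((e, p) : Cell) ∈ P := by
    intro p
    rw [hM, Finset.mem_image]
    exact ⟨fun ⟨c, hc, h⟩ => ⟨c.1, by rw [← h]; exact hc⟩, fun ⟨e, he⟩ => ⟨_, he, rfl⟩⟩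
  have hsub : ∀ c ∈ P, (c.1 = 0 ∨ c.1 = 1) ∧ c.2 ∈ M := by
    intro c hc
    have := h.subset_prism c hc
    push_cast at this
    exact ⟨by omega, Finset.mem_image_of_mem _ hc⟩
  have hcover : ∀ p ∈ M, ((0, p) : Cell) ∈ P ∨ ((1, p) : Cell) ∈ P := by
    intro p hp
    obtain ⟨e, he⟩ := (memM p).1 hp
    rcases (hsub _ he).1 with h | h <;> simp only at h <;> subst h
    · exact Or.inl he
    · exact Or.inr he
  have hbox : FillsBox 0 ((b : ℤ) - 1) 0 ((k : ℤ) - 1) M := by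
    refine ⟨fun p hp => ?_, ?_, ?_, ?_, ?_⟩
    · obtain ⟨e, he⟩ := (memM p).1 hp
      have := h.subset_prism _ he
      simp only at this
      omega
    · obtain ⟨⟨x, y, z⟩, hc, h'⟩ := h.touches_y_low
      simp only at h'; subst h'
      exact ⟨z, (memM _).2 ⟨x, hc⟩⟩
    · obtain ⟨⟨x, y, z⟩, hc, h'⟩ := h.touches_y_high
      simp only at h'; subst h'
      exact ⟨z, (memM _).2 ⟨x, hc⟩⟩
    · obtain ⟨⟨x, y, z⟩, hc, h'⟩ := h.touches_z_low
      simp only at h'; subst h'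
      exact ⟨y, (memM _).2 ⟨x, hc⟩⟩
    · obtain ⟨⟨x, y, z⟩, hc, h'⟩ := h.touches_z_high
      simp only at h'; subst h'
      exact ⟨y, (memM _).2 ⟨x, hc⟩⟩
  obtain ⟨y₀, y₁, z₀, z₁, hbox', hle, hslim⟩ := (finConn_image_snd h.polyomino).exists_box
  rw [← hM] at hbox' hle hslim
  obtain ⟨rfl, rfl, rfl, rfl⟩ := hbox.unique hbox'
  have hcard := card_two_layers hsub hcover
  set W := M.filter fun p => ((0, p) : Cell) ∈ P ∧ ((1, p) : Cell) ∈ P with hW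
  -- P meets both layers, hence contains a face-adjacent pair crossing between them; this pair lies
  -- over a doubled cell.
  have hWpos : 0 < W.card := by
    obtain ⟨c, hc, hc0⟩ := h.touches_x_low
    obtain ⟨d, hd, hd1⟩ := h.touches_x_high
    obtain ⟨c, hc, d, hd, h0, h1, hadj⟩ := h.polyomino.exists_crossing Prod.fst 0
      ⟨c, hc, hc0.le⟩ ⟨d, hd, by rw [hd1]; norm_num⟩
    have e0 : c.1 = 0 := by have := (hsub c hc).1; omega
    have e1 : d.1 = 1 := by have := (hsub d hd).1; omega
    have e2 : c.2 = d.2 := by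
      rcases faceGraph_adj.1 hadj with ⟨h', _⟩ | ⟨h', _⟩
      · omega
      · exact h'
    rw [Finset.card_pos]
    refine ⟨c.2, Finset.mem_filter.2 ⟨(hsub c hc).2, ?_, ?_⟩⟩
    · rw [← e0]; exact hc
    · rw [e2, ← e1]; exact hd
  refine ⟨by omega, fun hP => ?_⟩
  have hS := hslim (by omega)
  refine ⟨M, hS, ?_⟩
  have hW1 : W.card = 1 := by omega
  obtain ⟨v, hv⟩ := Finset.card_eq_one.1 hW1
  have hvM : v ∈ M := (Finset.mem_filter.1 (hv ▸ Finset.mem_singleton_self v : v ∈ W)).1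
  refine ⟨v, hvM, hsub, hcover, fun p hp => ?_, ?_⟩
  · rw [← hv, hW, Finset.mem_filter]
    exact ⟨fun h => ⟨hp, h⟩, fun h => h.2⟩
  -- P must cross from column z to column z + 1 inside some layer. The crossing projects to an edge
  -- of M between these columns, and M has only one.
  have colCase : ∀ y z, (y, z) ∈ M → (y, z + 1) ∈ M →
      ∃ x : ℤ, ((x, y, z) : Cell) ∈ P ∧ ((x, y, z + 1) : Cell) ∈ P := by
    intro y z hp hq
    obtain ⟨e, he⟩ := (memM _).1 hp
    obtain ⟨f, hf⟩ := (memM _).1 hq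
    obtain ⟨⟨x, y', z'⟩, hc, ⟨x', y'', z''⟩, hd, h0, h1, hadj⟩ :=
      h.polyomino.exists_crossing (fun c => c.2.2) z ⟨_, he, le_rfl⟩ ⟨_, hf, by simp⟩
    rw [faceGraph_adj] at hadj
    simp only [GridAdj, Prod.mk.injEq] at hadj h0 h1
    have : x' = x ∧ y'' = y' ∧ z' = z ∧ z'' = z + 1 := by omega
    obtain ⟨rfl, rfl, rfl, rfl⟩ := this
    obtain rfl := hS.col_edge_unique hp hq ((memM _).2 ⟨_, hc⟩) ((memM _).2 ⟨_, hd⟩)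
    exact ⟨_, hc, hd⟩
  have rowCase : ∀ y z, (y, z) ∈ M → (y + 1, z) ∈ M →
      ∃ x : ℤ, ((x, y, z) : Cell) ∈ P ∧ ((x, y + 1, z) : Cell) ∈ P := by
    intro y z hp hq
    obtain ⟨e, he⟩ := (memM _).1 hp
    obtain ⟨f, hf⟩ := (memM _).1 hq
    obtain ⟨⟨x, y', z'⟩, hc, ⟨x', y'', z''⟩, hd, h0, h1, hadj⟩ :=
      h.polyomino.exists_crossing (fun c => c.2.1) y ⟨_, he, le_rfl⟩ ⟨_, hf, by simp⟩
    rw [faceGraph_adj] at hadj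
    simp only [GridAdj, Prod.mk.injEq] at hadj h0 h1
    have : x' = x ∧ z'' = z' ∧ y' = y ∧ y'' = y + 1 := by omega
    obtain ⟨rfl, rfl, rfl, rfl⟩ := this
    obtain rfl := hS.row_edge_unique hp hq ((memM _).2 ⟨_, hc⟩) ((memM _).2 ⟨_, hd⟩)
    exact ⟨_, hc, hd⟩
  rintro ⟨y, z⟩ hp ⟨y', z'⟩ hq hpq
  simp only [GridAdj] at hpq
  rcases hpq with ⟨rfl, rfl | rfl⟩ | ⟨rfl, rfl | rfl⟩
  · obtain ⟨x, h1, h2⟩ := colCase _ _ hq hp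
    exact ⟨x, h2, h1⟩
  · exact colCase _ _ hp hq
  · obtain ⟨x, h1, h2⟩ := rowCase _ _ hq hp
    exact ⟨x, h2, h1⟩
  · exact rowCase _ _ hp hq

/-- The minimal polyominoes in a box with two layers are the lifts of slim sets. -/
theorem mem_minPolyominoes_two {b k : ℕ} {P : Finset Cell}
    (hex : ∃ M, Slim 0 ((b : ℤ) - 1) 0 ((k : ℤ) - 1) M) :
    P ∈ minPolyominoes 2 b k ↔ ∃ M, Slim 0 ((b : ℤ) - 1) 0 ((k : ℤ) - 1) M ∧ P ∈ lifts M := by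
  have hlift : ∀ {M Q}, Slim 0 ((b : ℤ) - 1) 0 ((k : ℤ) - 1) M → Q ∈ lifts M →
      IsInscribed 2 b k Q ∧ Q.card = b + k := by
    intro M Q hM hQ
    obtain ⟨v, hv, hQ⟩ := Finset.mem_biUnion.1 hQ
    rw [mem_layerings] at hQ
    refine ⟨hQ.isInscribed hM hv, ?_⟩
    have := hQ.card_eq hv
    have := hM.card_eq
    omega
  constructor
  · rintro ⟨hP, hmin⟩
    obtain ⟨M, hM⟩ := hex
    obtain ⟨Q, hQ⟩ : (lifts M).Nonempty := by
      rw [← Finset.card_pos, hM.card_lifts, degWeight]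
      exact Finset.sum_pos (fun _ _ => by positivity) hM.finConn.1
    have h1 := hmin Q (hlift hM hQ).1
    rw [(hlift hM hQ).2] at h1
    obtain ⟨M', hM', v, hv, hl⟩ := hP.card_ge.2 (le_antisymm h1 hP.card_ge.1)
    exact ⟨M', hM', Finset.mem_biUnion.2 ⟨v, hv, mem_layerings.2 hl⟩⟩
  · rintro ⟨M, hM, hP⟩
    refine ⟨(hlift hM hP).1, fun Q hQ => ?_⟩
    rw [(hlift hM hP).2]
    exact hQ.card_ge.1

/-- Lifts of different slim sets differ because a lift projects back to its slim set. -/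
theorem numMinPolyominoes_two {b k : ℕ} {F : Finset (Finset (ℤ × ℤ))} (hne : F.Nonempty)
    (hF : ∀ M, M ∈ F ↔ Slim 0 ((b : ℤ) - 1) 0 ((k : ℤ) - 1) M) :
    numMinPolyominoes 2 b k = ∑ M ∈ F, degWeight M := by
  classical
  have hset : minPolyominoes 2 b k = ((F.biUnion lifts : Finset (Finset Cell)) : Set _) := by
    ext P
    obtain ⟨M, hM⟩ := hne
    rw [mem_minPolyominoes_two ⟨M, (hF M).1 hM⟩, Finset.mem_coe, Finset.mem_biUnion]
    simp only [hF]
  rw [numMinPolyominoes, hset, Set.ncard_coe_finset, Finset.card_biUnion]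
  · exact Finset.sum_congr rfl fun M hM => ((hF M).1 hM).card_lifts
  · intro M _ M' _ hne
    rw [Function.onFun, Finset.disjoint_left]
    intro P hP hP'
    obtain ⟨v, _, hP⟩ := Finset.mem_biUnion.1 hP
    obtain ⟨v', _, hP'⟩ := Finset.mem_biUnion.1 hP'
    rw [mem_layerings] at hP hP'
    exact hne (hP.image_snd.symm.trans hP'.image_snd)

/-! ### Lattice paths and the shape of slim sets -/

/-- The cells of a lattice path from `(a, b)` to `(i, j)` with steps down and to the right. -/
inductive StairPath (a b : ℤ) : ℤ → ℤ → (ℤ → ℤ → Prop) → Prop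
  | nil : StairPath a b a b fun y z => y = a ∧ z = b
  | down {i j : ℤ} {S : ℤ → ℤ → Prop} (h : StairPath a b i j S) :
      StairPath a b (i + 1) j fun y z => S y z ∨ (y = i + 1 ∧ z = j)
  | right {i j : ℤ} {S : ℤ → ℤ → Prop} (h : StairPath a b i j S) :
      StairPath a b i (j + 1) fun y z => S y z ∨ (y = i ∧ z = j + 1)

namespace StairPath

variable {a b i j : ℤ} {S T : ℤ → ℤ → Prop}

theorem congr (h : StairPath a b i j S) (hST : ∀ y z, S y z ↔ T y z) : StairPath a b i j T := by
  have : S = T := by funext y z; exact propext (hST y z)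
  exact this ▸ h

theorem le (h : StairPath a b i j S) : a ≤ i ∧ b ≤ j := by
  induction h with
  | nil => omega
  | down h ih => omega
  | right h ih => omega

theorem bounds (h : StairPath a b i j S) {y z : ℤ} (hS : S y z) :
    a ≤ y ∧ y ≤ i ∧ b ≤ z ∧ z ≤ j := by
  induction h with
  | nil => omega
  | down h ih => have := h.le; rcases hS with hS | hS <;> grind
  | right h ih => have := h.le; rcases hS with hS | hS <;> grind

theorem source_mem (h : StairPath a b i j S) : S a b := by
  induction h with
  | nil => exact ⟨rfl, rfl⟩
  | down h ih => exact Or.inl ih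
  | right h ih => exact Or.inl ih

theorem target_mem (h : StairPath a b i j S) : S i j := by
  cases h with
  | nil => exact ⟨rfl, rfl⟩
  | down h => exact Or.inr ⟨rfl, rfl⟩
  | right h => exact Or.inr ⟨rfl, rfl⟩

theorem prepend_down (h : StairPath a b i j S) :
    StairPath (a - 1) b i j fun y z => S y z ∨ (y = a - 1 ∧ z = b) := by
  induction h with
  | nil =>
    have := (nil (a := a - 1) (b := b)).down
    rw [sub_add_cancel] at this
    exact this.congr fun y z => by tauto
  | down h ih => exact ih.down.congr fun y z => by tauto
  | right h ih => exact ih.right.congr fun y z => by tauto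

theorem prepend_right (h : StairPath a b i j S) :
    StairPath a (b - 1) i j fun y z => S y z ∨ (y = a ∧ z = b - 1) := by
  induction h with
  | nil =>
    have := (nil (a := a) (b := b - 1)).right
    rw [sub_add_cancel] at this
    exact this.congr fun y z => by tauto
  | down h ih => exact ih.down.congr fun y z => by tauto
  | right h ih => exact ih.right.congr fun y z => by tauto

theorem transpose (h : StairPath a b i j S) : StairPath b a j i fun y z => S z y := by
  induction h with
  | nil => exact nil.congr fun y z => by tauto
  | down h ih => exact ih.right.congr fun y z => by tauto
  | right h ih => exact ih.down.congr fun y z => by tauto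

theorem rotate (h : StairPath a b i j S) :
    StairPath (-i) (-j) (-a) (-b) fun y z => S (-y) (-z) := by
  induction h with
  | nil => exact nil.congr fun y z => by omega
  | down h ih =>
    rw [neg_add]
    exact ih.prepend_down.congr fun y z => or_congr Iff.rfl (by omega)
  | right h ih =>
    rw [neg_add]
    exact ih.prepend_right.congr fun y z => or_congr Iff.rfl (by omega)

theorem extend_down (h : StairPath a b i j S) (d : ℕ) :
    StairPath a b (i + d) j fun y z => S y z ∨ (z = j ∧ i ≤ y ∧ y ≤ i + d) := by
  induction d with
  | zero =>
    have := h.target_mem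
    rw [Nat.cast_zero, add_zero]
    refine h.congr fun y z => ⟨Or.inl, ?_⟩
    rintro (h | ⟨rfl, h1, h2⟩)
    · exact h
    · rwa [le_antisymm h2 h1]
  | succ d ih =>
    have := ih.down
    rw [add_assoc] at this
    rw [Nat.cast_succ]
    exact this.congr fun y z => by rw [or_assoc]; exact or_congr Iff.rfl (by omega)

theorem vertical (h : StairPath a b i b S) {y z : ℤ} : S y z ↔ z = b ∧ a ≤ y ∧ y ≤ i := by
  -- The final column is freed from b so that induction on the path is possible.
  suffices ∀ j, StairPath a b i j S → j = b → (S y z ↔ z = b ∧ a ≤ y ∧ y ≤ i) from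
    this b h rfl
  clear h
  intro j h
  induction h with
  | nil => intro; omega
  | down h ih =>
    intro hj
    have := h.le
    have := ih hj
    grind
  | right h ih =>
    intro hj
    have := h.le
    omega

theorem of_vertical (h : a ≤ i) : StairPath a b i b fun y z => z = b ∧ a ≤ y ∧ y ≤ i := by
  have := (nil (a := a) (b := b)).extend_down (i - a).toNat
  have e : a + ((i - a).toNat : ℤ) = i := by omega
  rw [e] at this
  exact this.congr fun y z => by omega

/-- A path can be cut at any of its cells in the last column. -/
theorem split (h : StairPath a b i j S) {y : ℤ} (hy : S y j) :
    ∃ S', StairPath a b y j S' ∧ ∀ y' z', S y' z' ↔ S' y' z' ∨ (z' = j ∧ y ≤ y' ∧ y' ≤ i) := by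
  induction h with
  | nil =>
    obtain ⟨rfl, -⟩ := hy
    exact ⟨_, nil, fun y' z' => by omega⟩
  | @down i j S h ih =>
    rcases hy with hy | ⟨rfl, -⟩
    · obtain ⟨S', h1, h2⟩ := ih hy
      have := h.bounds hy
      refine ⟨S', h1, fun y' z' => ?_⟩
      beta_reduce
      rw [h2, or_assoc]
      exact or_congr Iff.rfl (by omega)
    · refine ⟨_, h.down, fun y' z' => ?_⟩
      rw [or_assoc]
      exact or_congr Iff.rfl (by omega)
  | @right i j S h ih =>
    rcases hy with hy | ⟨rfl, -⟩
    · have := h.bounds hy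
      omega
    · refine ⟨_, h.right, fun y' z' => ?_⟩
      rw [or_assoc]
      exact or_congr Iff.rfl (by omega)

end StairPath

/-- A lattice path with steps down and to the right, from whose first cell arms of lengths `l` and
`u` go to the left and up, and from whose last cell arms of lengths `r` and `d` go to the right and
down. -/
def IsArmedPath (M : ℤ → ℤ → Prop) : Prop :=
  ∃ (a b i j : ℤ) (S : ℤ → ℤ → Prop) (l u r d : ℕ), StairPath a b i j S ∧
    ∀ y z, M y z ↔ S y z ∨ (y = a ∧ b - l ≤ z ∧ z ≤ b) ∨ (z = b ∧ a - u ≤ y ∧ y ≤ a) ∨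
      (y = i ∧ j ≤ z ∧ z ≤ j + r) ∨ (z = j ∧ i ≤ y ∧ y ≤ i + d)

theorem IsArmedPath.congr {M M' : ℤ → ℤ → Prop} (h : IsArmedPath M) (hM : ∀ y z, M y z ↔ M' y z) :
    IsArmedPath M' := by
  have : M = M' := by funext y z; exact propext (hM y z)
  exact this ▸ h

theorem IsArmedPath.transpose {M : ℤ → ℤ → Prop} (h : IsArmedPath M) :
    IsArmedPath fun y z => M z y := by
  obtain ⟨a, b, i, j, S, l, u, r, d, hS, hM⟩ := h
  refine ⟨b, a, j, i, _, u, l, d, r, hS.transpose, fun y z => ?_⟩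
  beta_reduce
  rw [hM]
  tauto

theorem IsArmedPath.rotate {M : ℤ → ℤ → Prop} (h : IsArmedPath M) :
    IsArmedPath fun y z => M (-y) (-z) := by
  obtain ⟨a, b, i, j, S, l, u, r, d, hS, hM⟩ := h
  refine ⟨_, _, _, _, _, r, d, l, u, hS.rotate, fun y z => ?_⟩
  beta_reduce
  rw [hM]
  refine or_congr Iff.rfl ?_
  omega

/-- An armed path or the mirror image of one. -/
def IsArmedPathOrMirror (M : ℤ → ℤ → Prop) : Prop :=
  IsArmedPath M ∨ IsArmedPath fun y z => M y (-z)

theorem IsArmedPathOrMirror.congr {M M' : ℤ → ℤ → Prop} (h : IsArmedPathOrMirror M)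
    (hM : ∀ y z, M y z ↔ M' y z) : IsArmedPathOrMirror M' := by
  have : M = M' := by funext y z; exact propext (hM y z)
  exact this ▸ h

theorem IsArmedPathOrMirror.mirror {M : ℤ → ℤ → Prop} (h : IsArmedPathOrMirror M) :
    IsArmedPathOrMirror fun y z => M y (-z) :=
  h.symm.imp id fun h => h.congr fun y z => by beta_reduce; rw [neg_neg]

theorem IsArmedPathOrMirror.transpose {M : ℤ → ℤ → Prop} (h : IsArmedPathOrMirror M) :
    IsArmedPathOrMirror fun y z => M z y := by
  refine h.imp (fun h => h.transpose) fun h => ?_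
  exact h.rotate.transpose.congr fun y z => by beta_reduce; rw [neg_neg]

/-- A nonempty right arm is alone in the last column and gets longer. If it is empty, the path ends
in the last column and the new cell starts a right arm there: the path is cut or prolonged at row y₁
and what lies below becomes the down arm. Only when y₁ is above the start of the path does the
orientation change. -/
theorem IsArmedPath.add_right {M : ℤ → ℤ → Prop} {y₁ z₁ : ℤ} (h : IsArmedPath M)
    (hmax : ∀ y z, M y z → z ≤ z₁) (hm : M y₁ z₁) :
    IsArmedPathOrMirror fun y z => M y z ∨ (y = y₁ ∧ z = z₁ + 1) := by
  obtain ⟨a, b, i, j, S, l, u, r, d, hS, hM⟩ := h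
  have hle := hS.le
  have hr : j + r ≤ z₁ := hmax i (j + r) ((hM _ _).2 (by omega))
  rcases Nat.eq_zero_or_pos r with rfl | hrpos
  · have hj : z₁ = j := by
      rcases (hM _ _).1 hm with h | h
      · have := hS.bounds h; omega
      · omega
    subst hj
    by_cases hup : y₁ < a
    · have hm' := (hM _ _).1 hm
      have hbj : b = z₁ := by
        rcases hm' with h | h
        · have := hS.bounds h; omega
        · omega
      subst hbj
      have hSiff := fun y z => hS.vertical (y := y) (z := z)
      have hyu : a - u ≤ y₁ := by
        rcases hm' with h | h
        · rw [hSiff] at h; omega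
        · omega
      right
      -- Here the path is vertical. After mirroring, a path runs down from row y₁ to row a, the new
      -- cell is its left arm and the old left arm is its right arm.
      refine ⟨y₁, -b, a, -b, _, 1, (y₁ - (a - u)).toNat, l, (i + d - a).toNat,
        StairPath.of_vertical hup.le, fun y z => ?_⟩
      beta_reduce
      rw [hM, hSiff]
      omega
    · left
      have hcase : S y₁ z₁ ∨ (i ≤ y₁ ∧ y₁ ≤ i + d) := by
        rcases (hM _ _).1 hm with h | h | h | h | h
        · exact Or.inl h
        · left
          have : y₁ = a ∧ z₁ = b := by omega
          rw [this.1, this.2]; exact hS.source_mem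
        · left
          have : y₁ = a ∧ z₁ = b := by omega
          rw [this.1, this.2]; exact hS.source_mem
        · right; omega
        · right; omega
      rcases hcase with h | h
      · obtain ⟨S', hS', hSS'⟩ := hS.split h
        have := hS.bounds h
        refine ⟨a, b, y₁, z₁, S', l, u, 1, (i + d - y₁).toNat, hS', fun y z => ?_⟩
        beta_reduce
        rw [hM, hSS', or_assoc, or_assoc]
        refine or_congr Iff.rfl ?_
        omega
      · have hS' := hS.extend_down (y₁ - i).toNat
        have e : i + ((y₁ - i).toNat : ℤ) = y₁ := by omega
        rw [e] at hS'
        refine ⟨a, b, y₁, z₁, _, l, u, 1, (i + d - y₁).toNat, hS', fun y z => ?_⟩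
        beta_reduce
        rw [hM]
        simp only [or_assoc]
        refine or_congr Iff.rfl ?_
        omega
  · have hy : y₁ = i ∧ z₁ = j + r := by
      rcases (hM _ _).1 hm with h | h
      · have := hS.bounds h; omega
      · omega
    left
    refine ⟨a, b, i, j, S, l, u, r + 1, d, hS, fun y z => ?_⟩
    beta_reduce
    rw [hM, or_assoc]
    refine or_congr Iff.rfl ?_
    push_cast
    omega

theorem IsArmedPathOrMirror.add_right {M : ℤ → ℤ → Prop} {y₁ z₁ : ℤ} (h : IsArmedPathOrMirror M)
    (hmax : ∀ y z, M y z → z ≤ z₁) (hm : M y₁ z₁) :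
    IsArmedPathOrMirror fun y z => M y z ∨ (y = y₁ ∧ z = z₁ + 1) := by
  rcases h with h | h
  · exact h.add_right hmax hm
  -- A half turn converts the column mirror into a row mirror, which keeps the last column in place.
  · have h' : IsArmedPath fun y z => M (-y) z := h.rotate.congr fun y z => by rw [neg_neg]
    have := h'.add_right (y₁ := -y₁) (fun y z hyz => hmax _ _ hyz) (by rwa [neg_neg])
    rcases this with h | h
    · right
      exact h.rotate.congr fun y z => by beta_reduce; rw [neg_neg]; exact or_congr Iff.rfl (by omega)
    · left
      exact h.rotate.congr fun y z => by
        beta_reduce; rw [neg_neg, neg_neg]; exact or_congr Iff.rfl (by omega)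

theorem IsArmedPathOrMirror.add_left {M : ℤ → ℤ → Prop} {y₀ z₀ : ℤ} (h : IsArmedPathOrMirror M)
    (hmin : ∀ y z, M y z → z₀ ≤ z) (hm : M y₀ z₀) :
    IsArmedPathOrMirror fun y z => M y z ∨ (y = y₀ ∧ z = z₀ - 1) := by
  have := (h.mirror.add_right (y₁ := y₀) (z₁ := -z₀) (fun y z hyz => by have := hmin _ _ hyz; omega)
    (by rwa [neg_neg])).mirror
  exact this.congr fun y z => by rw [neg_neg]; exact or_congr Iff.rfl (by omega)

/-- The class is invariant under mirroring and transposition, so all four growth steps reduce to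
adding a cell on the right. -/
theorem Slim.isArmedPathOrMirror {y₀ y₁ z₀ z₁ : ℤ} {M : Finset (ℤ × ℤ)}
    (h : Slim y₀ y₁ z₀ z₁ M) : IsArmedPathOrMirror fun y z => (y, z) ∈ M := by
  induction h with
  | single a b =>
    left
    refine ⟨a, b, a, b, _, 0, 0, 0, 0, StairPath.nil, fun y z => ?_⟩
    beta_reduce
    rw [Finset.mem_singleton, Prod.mk.injEq]
    omega
  | down h hm ih =>
    refine (ih.transpose.add_right (fun y z hyz => ?_) hm).transpose.congr fun y z => ?_
    · exact (h.fillsBox.sub _ hyz).2.1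
    · rw [Finset.mem_insert, Prod.mk.injEq]; tauto
  | up h hm ih =>
    refine (ih.transpose.add_left (fun y z hyz => ?_) hm).transpose.congr fun y z => ?_
    · exact (h.fillsBox.sub _ hyz).1
    · rw [Finset.mem_insert, Prod.mk.injEq]; tauto
  | right h hm ih =>
    refine (ih.add_right (fun y z hyz => ?_) hm).congr fun y z => ?_
    · exact (h.fillsBox.sub _ hyz).2.2.2
    · rw [Finset.mem_insert, Prod.mk.injEq]; tauto
  | left h hm ih =>
    refine (ih.add_left (fun y z hyz => ?_) hm).congr fun y z => ?_
    · exact (h.fillsBox.sub _ hyz).2.2.1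
    · rw [Finset.mem_insert, Prod.mk.injEq]; tauto

/-! ### Attaching arms -/

/-- The straight segment of `n + 1` cells that starts at `p` and goes in direction `e`. -/
def arm (p e : ℤ × ℤ) (n : ℕ) : Finset (ℤ × ℤ) :=
  (Finset.range (n + 1)).image fun m : ℕ => (p.1 + m * e.1, p.2 + m * e.2)

theorem arm_zero (p e : ℤ × ℤ) : arm p e 0 = {p} := by simp [arm]

theorem arm_succ (p e : ℤ × ℤ) (n : ℕ) :
    arm p e (n + 1) =
      insert (p.1 + ((n + 1 : ℕ) : ℤ) * e.1, p.2 + ((n + 1 : ℕ) : ℤ) * e.2) (arm p e n) := by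
  rw [arm, Finset.range_add_one, Finset.image_insert, arm]

theorem mem_arm_right {a b y z : ℤ} {n : ℕ} :
    (y, z) ∈ arm (a, b) (0, 1) n ↔ y = a ∧ b ≤ z ∧ z ≤ b + n := by
  simp only [arm, Finset.mem_image, Finset.mem_range, Prod.mk.injEq]
  exact ⟨fun ⟨m, hm⟩ => by omega, fun h => ⟨(z - b).toNat, by omega⟩⟩

theorem mem_arm_left {a b y z : ℤ} {n : ℕ} :
    (y, z) ∈ arm (a, b) (0, -1) n ↔ y = a ∧ b - n ≤ z ∧ z ≤ b := by
  simp only [arm, Finset.mem_image, Finset.mem_range, Prod.mk.injEq]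
  exact ⟨fun ⟨m, hm⟩ => by omega, fun h => ⟨(b - z).toNat, by omega⟩⟩

theorem mem_arm_down {a b y z : ℤ} {n : ℕ} :
    (y, z) ∈ arm (a, b) (1, 0) n ↔ z = b ∧ a ≤ y ∧ y ≤ a + n := by
  simp only [arm, Finset.mem_image, Finset.mem_range, Prod.mk.injEq]
  exact ⟨fun ⟨m, hm⟩ => by omega, fun h => ⟨(y - a).toNat, by omega⟩⟩

theorem mem_arm_up {a b y z : ℤ} {n : ℕ} :
    (y, z) ∈ arm (a, b) (-1, 0) n ↔ z = b ∧ a - n ≤ y ∧ y ≤ a := by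
  simp only [arm, Finset.mem_image, Finset.mem_range, Prod.mk.injEq]
  exact ⟨fun ⟨m, hm⟩ => by omega, fun h => ⟨(a - y).toNat, by omega⟩⟩

theorem union_arm_zero {M : Finset (ℤ × ℤ)} {p : ℤ × ℤ} (hp : p ∈ M) (e : ℤ × ℤ) :
    M ∪ arm p e 0 = M := by
  rw [arm_zero, Finset.union_eq_left, Finset.singleton_subset_iff]
  exact hp

theorem union_arm_succ (M : Finset (ℤ × ℤ)) (p e : ℤ × ℤ) (n : ℕ) :
    M ∪ arm p e (n + 1) =
      insert (p.1 + ((n + 1 : ℕ) : ℤ) * e.1, p.2 + ((n + 1 : ℕ) : ℤ) * e.2) (M ∪ arm p e n) := by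
  rw [arm_succ, Finset.union_insert]

/-- A unit vector along one of the axes. -/
def IsDirection (e : ℤ × ℤ) : Prop := e = (0, 1) ∨ e = (0, -1) ∨ e = (1, 0) ∨ e = (-1, 0)

/-- As p is extremal in direction e, the arm touches M only at p. The quantity weight - 2 ^ deg p +
2 deg p grows by exactly 4 with every cell: the first cell alters deg p, and each later one turns an
end of degree 1 into degree 2. The last conjunct supplies that degree in the induction. -/
theorem gridDeg_union_arm {M : Finset (ℤ × ℤ)} {p e : ℤ × ℤ} (he : IsDirection e) (hp : p ∈ M)
    (hM : ∀ c ∈ M, e.1 * c.1 + e.2 * c.2 ≤ e.1 * p.1 + e.2 * p.2) (n : ℕ) :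
    gridDeg (M ∪ arm p e n) p = gridDeg M p + (if n = 0 then 0 else 1) ∧
      (degWeight (M ∪ arm p e n) : ℤ) - 2 ^ gridDeg (M ∪ arm p e n) p +
          2 * gridDeg (M ∪ arm p e n) p =
        degWeight M - 2 ^ gridDeg M p + 2 * gridDeg M p + 4 * n ∧
      (n ≠ 0 → gridDeg (M ∪ arm p e n) (p.1 + n * e.1, p.2 + n * e.2) = 1) := by
  induction n with
  | zero => simp [union_arm_zero hp]
  | succ n ih =>
    obtain ⟨ih1, ih2, ih3⟩ := ih
    have hu : (p.1 + (n : ℤ) * e.1, p.2 + (n : ℤ) * e.2) ∈ M ∪ arm p e n :=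
      Finset.mem_union_right _ (Finset.mem_image.2 ⟨n, by simp, rfl⟩)
    have hall : ∀ c ∈ M ∪ arm p e n, e.1 * c.1 + e.2 * c.2 ≤ e.1 * p.1 + e.2 * p.2 + n ∧
        (e.1 * c.1 + e.2 * c.2 = e.1 * p.1 + e.2 * p.2 + n → n ≠ 0 →
          c = (p.1 + (n : ℤ) * e.1, p.2 + (n : ℤ) * e.2)) := by
      intro c hc
      rcases Finset.mem_union.1 hc with hc | hc
      · have := hM c hc
        exact ⟨by omega, fun h1 h2 => by omega⟩
      · obtain ⟨m, hm, rfl⟩ := Finset.mem_image.1 hc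
        rw [Finset.mem_range] at hm
        rcases he with rfl | rfl | rfl | rfl <;> simp only [Prod.mk.injEq] <;> omega
    have hx : (p.1 + ((n + 1 : ℕ) : ℤ) * e.1, p.2 + ((n + 1 : ℕ) : ℤ) * e.2) ∉ M ∪ arm p e n := by
      intro hx
      have := (hall _ hx).1
      rcases he with rfl | rfl | rfl | rfl <;> simp only at this <;> omega
    have hadj : ∀ q ∈ M ∪ arm p e n,
        GridAdj (p.1 + ((n + 1 : ℕ) : ℤ) * e.1, p.2 + ((n + 1 : ℕ) : ℤ) * e.2) q ↔
          q = (p.1 + (n : ℤ) * e.1, p.2 + (n : ℤ) * e.2) := by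
      intro q hq
      have := (hall q hq).1
      rw [Prod.ext_iff]
      rcases he with rfl | rfl | rfl | rfl <;> simp only [GridAdj] at * <;> omega
    rw [union_arm_succ]
    refine ⟨?_, ?_, fun _ => gridDeg_insert_self hu hadj⟩
    · rw [gridDeg_insert hx hadj (Finset.mem_union_left _ hp), ih1]
      rcases Nat.eq_zero_or_pos n with rfl | hn
      · simp
      · have : p ≠ (p.1 + (n : ℤ) * e.1, p.2 + (n : ℤ) * e.2) := by
          rw [ne_eq, Prod.ext_iff]
          rcases he with rfl | rfl | rfl | rfl <;> simp only <;> omega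
        simp [this, hn.ne']
    · rw [gridDeg_insert hx hadj (Finset.mem_union_left _ hp), degWeight_insert hu hx hadj]
      rcases Nat.eq_zero_or_pos n with rfl | hn
      · simp only [union_arm_zero hp]
        simp [pow_succ]
        ring
      · have : p ≠ (p.1 + (n : ℤ) * e.1, p.2 + (n : ℤ) * e.2) := by
          rw [ne_eq, Prod.ext_iff]
          rcases he with rfl | rfl | rfl | rfl <;> simp only <;> omega
        rw [if_neg this, ih3 hn.ne', add_zero]
        push_cast
        linarith

theorem Slim.union_arm_right {y₀ y₁ z₀ z₁ y : ℤ} {M : Finset (ℤ × ℤ)} (h : Slim y₀ y₁ z₀ z₁ M)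
    (hm : (y, z₁) ∈ M) (n : ℕ) : Slim y₀ y₁ z₀ (z₁ + n) (M ∪ arm (y, z₁) (0, 1) n) := by
  induction n with
  | zero => simpa [union_arm_zero hm] using h
  | succ n ih =>
    have := ih.right (y := y) (Finset.mem_union_right _ (by rw [mem_arm_right]; omega))
    rw [union_arm_succ]
    simpa [add_assoc] using this

theorem Slim.union_arm_left {y₀ y₁ z₀ z₁ y : ℤ} {M : Finset (ℤ × ℤ)} (h : Slim y₀ y₁ z₀ z₁ M)
    (hm : (y, z₀) ∈ M) (n : ℕ) : Slim y₀ y₁ (z₀ - n) z₁ (M ∪ arm (y, z₀) (0, -1) n) := by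
  induction n with
  | zero => simpa [union_arm_zero hm] using h
  | succ n ih =>
    have := ih.left (y := y) (Finset.mem_union_right _ (by rw [mem_arm_left]; omega))
    rw [union_arm_succ]
    have e1 : z₀ - (n : ℤ) - 1 = z₀ - ((n + 1 : ℕ) : ℤ) := by push_cast; ring
    have e2 : z₀ + ((n + 1 : ℕ) : ℤ) * -1 = z₀ - ((n + 1 : ℕ) : ℤ) := by ring
    simpa only [e1, e2, mul_zero, add_zero] using this

theorem Slim.union_arm_down {y₀ y₁ z₀ z₁ z : ℤ} {M : Finset (ℤ × ℤ)} (h : Slim y₀ y₁ z₀ z₁ M)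
    (hm : (y₁, z) ∈ M) (n : ℕ) : Slim y₀ (y₁ + n) z₀ z₁ (M ∪ arm (y₁, z) (1, 0) n) := by
  induction n with
  | zero => simpa [union_arm_zero hm] using h
  | succ n ih =>
    have := ih.down (z := z) (Finset.mem_union_right _ (by rw [mem_arm_down]; omega))
    rw [union_arm_succ]
    simpa [add_assoc] using this

theorem Slim.union_arm_up {y₀ y₁ z₀ z₁ z : ℤ} {M : Finset (ℤ × ℤ)} (h : Slim y₀ y₁ z₀ z₁ M)
    (hm : (y₀, z) ∈ M) (n : ℕ) : Slim (y₀ - n) y₁ z₀ z₁ (M ∪ arm (y₀, z) (-1, 0) n) := by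
  induction n with
  | zero => simpa [union_arm_zero hm] using h
  | succ n ih =>
    have := ih.up (z := z) (Finset.mem_union_right _ (by rw [mem_arm_up]; omega))
    rw [union_arm_succ]
    have e1 : y₀ - (n : ℤ) - 1 = y₀ - ((n + 1 : ℕ) : ℤ) := by push_cast; ring
    have e2 : y₀ + ((n + 1 : ℕ) : ℤ) * -1 = y₀ - ((n + 1 : ℕ) : ℤ) := by ring
    simpa only [e1, e2, mul_zero, add_zero] using this

/-! ### Corner paths and armed paths as finite families -/

/-- The cells `(i, 0), …, (i, j)` and `(0, j), …, (i, j)`. -/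
def cornerShape (i j : ℕ) : Finset (ℤ × ℤ) :=
  ({((i : ℤ), (j : ℤ))} ∪ arm (i, j) (0, -1) j) ∪ arm (i, j) (-1, 0) i

theorem mem_cornerShape {i j : ℕ} {y z : ℤ} :
    (y, z) ∈ cornerShape i j ↔ (y = i ∧ 0 ≤ z ∧ z ≤ j) ∨ (z = j ∧ 0 ≤ y ∧ y ≤ i) := by
  rw [cornerShape, Finset.mem_union, Finset.mem_union, mem_arm_left, mem_arm_up,
    Finset.mem_singleton, Prod.mk.injEq]
  omega

theorem slim_cornerShape (i j : ℕ) : Slim 0 i 0 j (cornerShape i j) := by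
  have h := ((Slim.single (i : ℤ) (j : ℤ)).union_arm_left (Finset.mem_singleton_self _)
    j).union_arm_up (Finset.mem_union_left _ (Finset.mem_singleton_self _)) i
  rwa [sub_self, sub_self] at h

theorem cornerShape_weight {i j : ℕ} (hi : i ≠ 0) (hj : j ≠ 0) :
    gridDeg (cornerShape i j) (i, j) = 2 ∧ (degWeight (cornerShape i j) : ℤ) = 4 * (i + j) := by
  obtain ⟨h1, h2, -⟩ := gridDeg_union_arm (M := {((i : ℤ), (j : ℤ))}) (p := (i, j)) (e := (0, -1))
    (Or.inr (Or.inl rfl)) (Finset.mem_singleton_self _)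
    (fun c hc => by rw [Finset.mem_singleton.1 hc]) j
  obtain ⟨h3, h4, -⟩ := gridDeg_union_arm (M := {((i : ℤ), (j : ℤ))} ∪ arm (i, j) (0, -1) j)
    (p := (i, j)) (e := (-1, 0)) (Or.inr (Or.inr (Or.inr rfl)))
    (Finset.mem_union_left _ (Finset.mem_singleton_self _))
    (fun c hc => by
      obtain ⟨y, z⟩ := c
      rw [Finset.mem_union, Finset.mem_singleton, mem_arm_left, Prod.mk.injEq] at hc
      simp only; omega) i
  rw [gridDeg_singleton, if_neg hj] at h1
  rw [h1, if_neg hi] at h3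
  rw [gridDeg_singleton, degWeight_singleton, h1] at h2
  rw [h3, h1] at h4
  refine ⟨h3, ?_⟩
  rw [cornerShape]
  push_cast at h2 h4
  linarith

/-- Cell sets that fill the box with rows `0, …, i` and columns `0, …, j` and end in its last
corner: a lattice path from the first corner, or a path starting in some other cell together with
the two arms going left and up from that cell. -/
def cornerPaths : ℕ → ℕ → Finset (Finset (ℤ × ℤ))
  | 0, 0 => {{(0, 0)}}
  | i + 1, 0 => (cornerPaths i 0).image (insert ((i : ℤ) + 1, 0))
  | 0, j + 1 => (cornerPaths 0 j).image (insert (0, (j : ℤ) + 1))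
  | i + 1, j + 1 =>
    (cornerPaths i (j + 1)).image (insert ((i : ℤ) + 1, (j : ℤ) + 1)) ∪
      (cornerPaths (i + 1) j).image (insert ((i : ℤ) + 1, (j : ℤ) + 1)) ∪
      {cornerShape (i + 1) (j + 1)}

theorem slim_of_mem_cornerPaths {i j : ℕ} {M : Finset (ℤ × ℤ)} (h : M ∈ cornerPaths i j) :
    Slim 0 i 0 j M ∧ ((i : ℤ), (j : ℤ)) ∈ M := by
  induction i, j using cornerPaths.induct generalizing M with
  | case1 =>
    rw [cornerPaths, Finset.mem_singleton] at h
    subst h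
    exact ⟨Slim.single 0 0, Finset.mem_singleton_self _⟩
  | case2 i ih =>
    rw [cornerPaths, Finset.mem_image] at h
    obtain ⟨M, hM, rfl⟩ := h
    push_cast
    exact ⟨(ih hM).1.down (ih hM).2, Finset.mem_insert_self _ _⟩
  | case3 j ih =>
    rw [cornerPaths, Finset.mem_image] at h
    obtain ⟨M, hM, rfl⟩ := h
    push_cast
    exact ⟨(ih hM).1.right (ih hM).2, Finset.mem_insert_self _ _⟩
  | case4 i j ih1 ih2 =>
    rw [cornerPaths, Finset.mem_union, Finset.mem_union, Finset.mem_image, Finset.mem_image,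
      Finset.mem_singleton] at h
    rcases h with (⟨M, hM, rfl⟩ | ⟨M, hM, rfl⟩) | rfl
    · have := ih1 hM
      push_cast at *
      exact ⟨this.1.down this.2, Finset.mem_insert_self _ _⟩
    · have := ih2 hM
      push_cast at *
      exact ⟨this.1.right this.2, Finset.mem_insert_self _ _⟩
    · exact ⟨slim_cornerShape _ _, by rw [mem_cornerShape]; omega⟩

theorem insert_down_mem_cornerPaths {i j : ℕ} {M : Finset (ℤ × ℤ)} (h : M ∈ cornerPaths i j) :
    insert ((i : ℤ) + 1, (j : ℤ)) M ∈ cornerPaths (i + 1) j := by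
  cases j with
  | zero => rw [cornerPaths]; exact Finset.mem_image_of_mem _ h
  | succ j =>
    rw [cornerPaths]
    push_cast
    exact Finset.mem_union_left _ (Finset.mem_union_left _ (Finset.mem_image_of_mem _ h))

theorem insert_right_mem_cornerPaths {i j : ℕ} {M : Finset (ℤ × ℤ)} (h : M ∈ cornerPaths i j) :
    insert ((i : ℤ), (j : ℤ) + 1) M ∈ cornerPaths i (j + 1) := by
  cases i with
  | zero => rw [cornerPaths]; exact Finset.mem_image_of_mem _ h
  | succ i =>
    rw [cornerPaths]
    push_cast
    exact Finset.mem_union_left _ (Finset.mem_union_right _ (Finset.mem_image_of_mem _ h))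

theorem union_arm_down_mem_cornerPaths {i j : ℕ} {M : Finset (ℤ × ℤ)} (h : M ∈ cornerPaths i j)
    (d : ℕ) : M ∪ arm (i, j) (1, 0) d ∈ cornerPaths (i + d) j := by
  induction d with
  | zero => rwa [union_arm_zero (slim_of_mem_cornerPaths h).2]
  | succ d ih =>
    have := insert_down_mem_cornerPaths ih
    rw [union_arm_succ]
    push_cast at *
    simpa only [add_assoc, mul_one, mul_zero, add_zero] using this

theorem union_arm_right_mem_cornerPaths {i j : ℕ} {M : Finset (ℤ × ℤ)} (h : M ∈ cornerPaths i j)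
    (d : ℕ) : M ∪ arm (i, j) (0, 1) d ∈ cornerPaths i (j + d) := by
  induction d with
  | zero => rwa [union_arm_zero (slim_of_mem_cornerPaths h).2]
  | succ d ih =>
    have := insert_right_mem_cornerPaths ih
    rw [union_arm_succ]
    push_cast at *
    simpa only [add_assoc, mul_one, mul_zero, add_zero] using this

/-- Attaches to the cell `(i, j)` an arm reaching column `K` and an arm reaching row `B`. -/
def addArms (B K i j : ℕ) (M : Finset (ℤ × ℤ)) : Finset (ℤ × ℤ) :=
  (M ∪ arm (i, j) (0, 1) (K - j)) ∪ arm (i, j) (1, 0) (B - i)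

theorem mem_addArms {B K i j : ℕ} (hi : i ≤ B) (hj : j ≤ K) {M : Finset (ℤ × ℤ)} {y z : ℤ} :
    (y, z) ∈ addArms B K i j M ↔ (y, z) ∈ M ∨ (y = i ∧ (j : ℤ) ≤ z ∧ z ≤ K) ∨
      (z = j ∧ (i : ℤ) ≤ y ∧ y ≤ B) := by
  rw [addArms, Finset.mem_union, Finset.mem_union, mem_arm_right, mem_arm_down, or_assoc]
  refine or_congr Iff.rfl ?_
  omega

theorem slim_addArms {B K i j : ℕ} (hi : i ≤ B) (hj : j ≤ K) {M : Finset (ℤ × ℤ)}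
    (h : M ∈ cornerPaths i j) : Slim 0 B 0 K (addArms B K i j M) := by
  obtain ⟨h1, h2⟩ := slim_of_mem_cornerPaths h
  have := (h1.union_arm_right h2 (K - j)).union_arm_down (Finset.mem_union_left _ h2) (B - i)
  have e1 : (i : ℤ) + ((B - i : ℕ) : ℤ) = B := by omega
  have e2 : (j : ℤ) + ((K - j : ℕ) : ℤ) = K := by omega
  rwa [e1, e2] at this

/-- Both arms are nonempty, so the degree g of the cell (i, j) rises by two: 2 ^ (g + 2) - 2 ^ g
gives the factor 3, and twice the rise gives the -4. -/
theorem degWeight_addArms {B K i j : ℕ} (hi : i < B) (hj : j < K) {M : Finset (ℤ × ℤ)}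
    (h : M ∈ cornerPaths i j) :
    (degWeight (addArms B K i j M) : ℤ) =
      degWeight M + 3 * 2 ^ gridDeg M (i, j) + 4 * ((B : ℤ) + K - i - j) - 4 := by
  obtain ⟨hs, hm⟩ := slim_of_mem_cornerPaths h
  have hbox := hs.fillsBox.sub
  obtain ⟨h1, h2, -⟩ := gridDeg_union_arm (p := (i, j)) (e := (0, 1)) (Or.inl rfl) hm
    (fun c hc => by have := hbox c hc; simp only; omega) (K - j)
  obtain ⟨h3, h4, -⟩ := gridDeg_union_arm (M := M ∪ arm (i, j) (0, 1) (K - j)) (p := (i, j))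
    (e := (1, 0)) (Or.inr (Or.inr (Or.inl rfl))) (Finset.mem_union_left _ hm)
    (fun c hc => by
      obtain ⟨y, z⟩ := c
      rw [Finset.mem_union, mem_arm_right] at hc
      rcases hc with hc | hc
      · have := hbox _ hc; simp only at *; omega
      · simp only; omega) (B - i)
  rw [if_neg (by omega)] at h1 h3
  rw [h1] at h2 h3
  rw [h3, h1] at h4
  rw [addArms]
  have e1 : ((B - i : ℕ) : ℤ) = B - i := by omega
  have e2 : ((K - j : ℕ) : ℤ) = K - j := by omega
  rw [e1] at h4
  rw [e2] at h2
  push_cast at h2 h4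
  rw [pow_succ, pow_succ] at h4
  rw [pow_succ] at h2
  linarith

/-- The armed lattice paths that fill the box with rows `0, …, B` and columns `0, …, K`. -/
def armedPaths (B K : ℕ) : Finset (Finset (ℤ × ℤ)) :=
  cornerPaths B K ∪ (Finset.range B ×ˢ Finset.range K).biUnion fun p =>
    (cornerPaths p.1 p.2).image (addArms B K p.1 p.2)

theorem mem_armedPaths {B K : ℕ} {M : Finset (ℤ × ℤ)} : M ∈ armedPaths B K ↔
    M ∈ cornerPaths B K ∨ ∃ i < B, ∃ j < K, ∃ M' ∈ cornerPaths i j, addArms B K i j M' = M := by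
  simp only [armedPaths, Finset.mem_union, Finset.mem_biUnion, Finset.mem_product, Finset.mem_range,
    Finset.mem_image, Prod.exists]
  refine or_congr Iff.rfl ?_
  constructor
  · rintro ⟨i, j, ⟨hi, hj⟩, h⟩; exact ⟨i, hi, j, hj, h⟩
  · rintro ⟨i, hi, j, hj, h⟩; exact ⟨i, j, ⟨hi, hj⟩, h⟩

theorem slim_of_mem_armedPaths {B K : ℕ} {M : Finset (ℤ × ℤ)} (h : M ∈ armedPaths B K) :
    Slim 0 B 0 K M := by
  rcases mem_armedPaths.1 h with h | ⟨i, hi, j, hj, M', hM', rfl⟩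
  · exact (slim_of_mem_cornerPaths h).1
  · exact slim_addArms hi.le hj.le hM'

/-- With one arm empty, the L is a straight path from the first corner; only two nonempty arms need
the separate `cornerShape`. -/
theorem exists_cornerPath_of_arms (u l : ℕ) : ∃ M ∈ cornerPaths u l, ∀ y z,
    (y, z) ∈ M ↔ (y = u ∧ 0 ≤ z ∧ z ≤ l) ∨ (z = l ∧ 0 ≤ y ∧ y ≤ u) := by
  have h0 : {(0, 0)} ∈ cornerPaths 0 0 := by rw [cornerPaths]; exact Finset.mem_singleton_self _
  rcases Nat.eq_zero_or_pos u with rfl | hu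
  · have := union_arm_right_mem_cornerPaths h0 l
    rw [zero_add] at this
    refine ⟨_, this, fun y z => ?_⟩
    rw [Finset.mem_union, mem_arm_right, Finset.mem_singleton, Prod.mk.injEq]
    omega
  rcases Nat.eq_zero_or_pos l with rfl | hl
  · have := union_arm_down_mem_cornerPaths h0 u
    rw [zero_add] at this
    refine ⟨_, this, fun y z => ?_⟩
    rw [Finset.mem_union, mem_arm_down, Finset.mem_singleton, Prod.mk.injEq]
    omega
  refine ⟨cornerShape u l, ?_, fun y z => mem_cornerShape⟩
  obtain ⟨u, rfl⟩ := Nat.exists_eq_succ_of_ne_zero hu.ne'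
  obtain ⟨l, rfl⟩ := Nat.exists_eq_succ_of_ne_zero hl.ne'
  rw [Nat.succ_eq_add_one, Nat.succ_eq_add_one, cornerPaths]
  exact Finset.mem_union_right _ (Finset.mem_singleton_self _)

theorem StairPath.exists_cornerPath {u l : ℕ} {i j : ℤ} {S : ℤ → ℤ → Prop}
    (h : StairPath u l i j S) : ∃ i' j' : ℕ, i = i' ∧ j = j' ∧ ∃ M ∈ cornerPaths i' j', ∀ y z,
      (y, z) ∈ M ↔ S y z ∨ (y = u ∧ 0 ≤ z ∧ z ≤ l) ∨ (z = l ∧ 0 ≤ y ∧ y ≤ u) := by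
  induction h with
  | nil =>
    obtain ⟨M, hM, h⟩ := exists_cornerPath_of_arms u l
    refine ⟨u, l, rfl, rfl, M, hM, fun y z => ?_⟩
    rw [h]
    omega
  | down h ih =>
    obtain ⟨i', j', rfl, rfl, M, hM, h⟩ := ih
    refine ⟨i' + 1, j', by push_cast; rfl, rfl, _, insert_down_mem_cornerPaths hM, fun y z => ?_⟩
    rw [Finset.mem_insert, h, Prod.mk.injEq]
    tauto
  | right h ih =>
    obtain ⟨i', j', rfl, rfl, M, hM, h⟩ := ih
    refine ⟨i', j' + 1, rfl, by push_cast; rfl, _, insert_right_mem_cornerPaths hM, fun y z => ?_⟩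
    rw [Finset.mem_insert, h, Prod.mk.injEq]
    tauto

/-- The box forces each arm to reach its side. If one of the two final arms is empty, the other is
absorbed into the path, which then ends in the last corner. -/
theorem IsArmedPath.mem_armedPaths {B K : ℕ} {M : Finset (ℤ × ℤ)} (hbox : FillsBox 0 B 0 K M)
    (h : IsArmedPath fun y z => (y, z) ∈ M) : M ∈ armedPaths B K := by
  obtain ⟨a, b, i, j, S, l, u, r, d, hS, hM⟩ := h
  have hsub : ∀ y z, (y, z) ∈ M → 0 ≤ y ∧ y ≤ B ∧ 0 ≤ z ∧ z ≤ K := fun y z h => hbox.sub _ h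
  have hle := hS.le
  have h1 := hsub a (b - l) ((hM _ _).2 (by omega))
  have h2 := hsub (a - u) b ((hM _ _).2 (by omega))
  have h3 := hsub i (j + r) ((hM _ _).2 (by omega))
  have h4 := hsub (i + d) j ((hM _ _).2 (by omega))
  have hb : b = l := by
    obtain ⟨y, hy⟩ := hbox.left
    rcases (hM _ _).1 hy with h | h
    · have := hS.bounds h; omega
    · omega
  have ha : a = u := by
    obtain ⟨y, hy⟩ := hbox.top
    rcases (hM _ _).1 hy with h | h
    · have := hS.bounds h; omega
    · omega
  have hj : j + r = K := by
    obtain ⟨y, hy⟩ := hbox.right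
    rcases (hM _ _).1 hy with h | h
    · have := hS.bounds h; omega
    · omega
  have hi : i + d = B := by
    obtain ⟨y, hy⟩ := hbox.bot
    rcases (hM _ _).1 hy with h | h
    · have := hS.bounds h; omega
    · omega
  subst ha hb
  obtain ⟨i, j, rfl, rfl, M', hM', hmem⟩ := hS.exists_cornerPath
  have hMM' : ∀ y z, (y, z) ∈ M ↔ (y, z) ∈ M' ∨ (y = i ∧ j ≤ z ∧ z ≤ j + r) ∨
      (z = j ∧ i ≤ y ∧ y ≤ i + d) := by
    intro y z
    refine (hM y z).trans ?_
    rw [hmem, or_assoc]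
    refine or_congr Iff.rfl ?_
    omega
  have hend := (slim_of_mem_cornerPaths hM').2
  rw [_root_.mem_armedPaths]
  rcases Nat.eq_zero_or_pos r with rfl | hr
  · left
    have := union_arm_down_mem_cornerPaths hM' d
    obtain rfl : B = i + d := by omega
    obtain rfl : K = j := by omega
    convert this using 1
    ext ⟨y, z⟩
    rw [hMM', Finset.mem_union, mem_arm_down]
    refine ⟨?_, Or.imp_right Or.inr⟩
    rintro (h | h | h)
    · exact Or.inl h
    · left
      have : y = i ∧ z = K := by omega
      rwa [this.1, this.2]
    · exact Or.inr h
  rcases Nat.eq_zero_or_pos d with rfl | hd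
  · left
    have := union_arm_right_mem_cornerPaths hM' r
    obtain rfl : B = i := by omega
    obtain rfl : K = j + r := by omega
    convert this using 1
    ext ⟨y, z⟩
    rw [hMM', Finset.mem_union, mem_arm_right]
    refine ⟨?_, Or.imp_right Or.inl⟩
    rintro (h | h | h)
    · exact Or.inl h
    · exact Or.inr h
    · left
      have : y = B ∧ z = j := by omega
      rwa [this.1, this.2]
  · right
    refine ⟨i, by omega, j, by omega, M', hM', ?_⟩
    ext ⟨y, z⟩
    rw [mem_addArms (by omega) (by omega), hMM', hi, hj]

/-! ### Recursions and closed forms for corner paths -/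

theorem sum_image_insert {F : Finset (Finset (ℤ × ℤ))} {x : ℤ × ℤ} (hx : ∀ M ∈ F, x ∉ M)
    (f : Finset (ℤ × ℤ) → ℤ) :
    ∑ M ∈ F.image (insert x), f M = ∑ M ∈ F, f (insert x M) := by
  refine Finset.sum_image fun M hM M' hM' h => ?_
  rw [← Finset.erase_insert (hx M hM), ← Finset.erase_insert (hx M' hM')]
  exact congrArg (fun N => Finset.erase N x) h

theorem notMem_of_row_gt {i j : ℕ} {M : Finset (ℤ × ℤ)} (h : M ∈ cornerPaths i j) {y z : ℤ}
    (hy : (i : ℤ) < y) : (y, z) ∉ M := fun hm => by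
  have := (slim_of_mem_cornerPaths h).1.fillsBox.sub _ hm
  simp only at this; omega

theorem notMem_of_col_gt {i j : ℕ} {M : Finset (ℤ × ℤ)} (h : M ∈ cornerPaths i j) {y z : ℤ}
    (hz : (j : ℤ) < z) : (y, z) ∉ M := fun hm => by
  have := (slim_of_mem_cornerPaths h).1.fillsBox.sub _ hm
  simp only at this; omega

theorem sum_cornerPaths_succ_zero (f : Finset (ℤ × ℤ) → ℤ) (i : ℕ) :
    ∑ M ∈ cornerPaths (i + 1) 0, f M =
      ∑ M ∈ cornerPaths i 0, f (insert ((i : ℤ) + 1, ((0 : ℕ) : ℤ)) M) := by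
  rw [cornerPaths]
  exact sum_image_insert (fun M hM => notMem_of_row_gt hM (by omega)) f

theorem sum_cornerPaths_zero_succ (f : Finset (ℤ × ℤ) → ℤ) (j : ℕ) :
    ∑ M ∈ cornerPaths 0 (j + 1), f M =
      ∑ M ∈ cornerPaths 0 j, f (insert (((0 : ℕ) : ℤ), (j : ℤ) + 1) M) := by
  rw [cornerPaths]
  exact sum_image_insert (fun M hM => notMem_of_col_gt hM (by omega)) f

/-- The three classes are told apart by the neighbours of the last corner that they contain: only
the upper one, only the left one, or both. -/
theorem sum_cornerPaths_succ_succ (f : Finset (ℤ × ℤ) → ℤ) (i j : ℕ) :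
    ∑ M ∈ cornerPaths (i + 1) (j + 1), f M =
      ∑ M ∈ cornerPaths i (j + 1), f (insert ((i : ℤ) + 1, ((j + 1 : ℕ) : ℤ)) M) +
        ∑ M ∈ cornerPaths (i + 1) j, f (insert (((i + 1 : ℕ) : ℤ), (j : ℤ) + 1) M) +
        f (cornerShape (i + 1) (j + 1)) := by
  have hup : ∀ M ∈ cornerPaths i (j + 1), ((i : ℤ) + 1, (j : ℤ)) ∉
      insert ((i : ℤ) + 1, (j : ℤ) + 1) M := by
    intro M hM h
    rcases Finset.mem_insert.1 h with h | h
    · simp at h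
    · exact notMem_of_row_gt hM (by omega) h
  have hleft : ∀ M ∈ cornerPaths (i + 1) j, ((i : ℤ), (j : ℤ) + 1) ∉
      insert ((i : ℤ) + 1, (j : ℤ) + 1) M := by
    intro M hM h
    rcases Finset.mem_insert.1 h with h | h
    · simp at h
    · exact notMem_of_col_gt hM (by omega) h
  rw [cornerPaths, Finset.sum_union, Finset.sum_union, Finset.sum_singleton,
    sum_image_insert (fun M hM => notMem_of_row_gt hM (by omega)),
    sum_image_insert (fun M hM => notMem_of_col_gt hM (by omega))]
  · push_cast; rfl
  · rw [Finset.disjoint_left]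
    intro N h h'
    obtain ⟨M, hM, rfl⟩ := Finset.mem_image.1 h
    obtain ⟨M', hM', h'⟩ := Finset.mem_image.1 h'
    apply hup M hM
    rw [← h']
    have := (slim_of_mem_cornerPaths hM').2
    push_cast at this
    exact Finset.mem_insert_of_mem this
  · rw [Finset.disjoint_singleton_right]
    intro h
    rcases Finset.mem_union.1 h with h | h
    · obtain ⟨M, hM, h⟩ := Finset.mem_image.1 h
      apply hup M hM
      rw [h, mem_cornerShape]
      omega
    · obtain ⟨M, hM, h⟩ := Finset.mem_image.1 h
      apply hleft M hM
      rw [h, mem_cornerShape]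
      omega

theorem insert_down_weight {i j : ℕ} {M : Finset (ℤ × ℤ)} (h : M ∈ cornerPaths i j) :
    gridDeg (insert ((i : ℤ) + 1, (j : ℤ)) M) ((i : ℤ) + 1, (j : ℤ)) = 1 ∧
    degWeight (insert ((i : ℤ) + 1, (j : ℤ)) M) = degWeight M + 2 ^ gridDeg M (i, j) + 2 := by
  obtain ⟨hs, hm⟩ := slim_of_mem_cornerPaths h
  have hadj : ∀ q ∈ M, GridAdj ((i : ℤ) + 1, (j : ℤ)) q ↔ q = ((i : ℤ), (j : ℤ)) := by
    intro q hq
    have := hs.fillsBox.sub q hq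
    rw [Prod.ext_iff]; simp only [GridAdj]; omega
  exact ⟨gridDeg_insert_self hm hadj, degWeight_insert hm (notMem_of_row_gt h (by omega)) hadj⟩

theorem insert_right_weight {i j : ℕ} {M : Finset (ℤ × ℤ)} (h : M ∈ cornerPaths i j) :
    gridDeg (insert ((i : ℤ), (j : ℤ) + 1) M) ((i : ℤ), (j : ℤ) + 1) = 1 ∧
    degWeight (insert ((i : ℤ), (j : ℤ) + 1) M) = degWeight M + 2 ^ gridDeg M (i, j) + 2 := by
  obtain ⟨hs, hm⟩ := slim_of_mem_cornerPaths h
  have hadj : ∀ q ∈ M, GridAdj ((i : ℤ), (j : ℤ) + 1) q ↔ q = ((i : ℤ), (j : ℤ)) := by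
    intro q hq
    have := hs.fillsBox.sub q hq
    rw [Prod.ext_iff]; simp only [GridAdj]; omega
  exact ⟨gridDeg_insert_self hm hadj, degWeight_insert hm (notMem_of_col_gt h (by omega)) hadj⟩

/-- The number of corner paths. -/
def cornerCount (i j : ℕ) : ℤ := ∑ _M ∈ cornerPaths i j, 1

/-- The sum of `2 ^ degree` of the last cell over all corner paths. -/
def cornerEndSum (i j : ℕ) : ℤ := ∑ M ∈ cornerPaths i j, 2 ^ gridDeg M (i, j)

/-- The sum of the weights of all corner paths. -/
def cornerWeightSum (i j : ℕ) : ℤ := ∑ M ∈ cornerPaths i j, (degWeight M : ℤ)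

theorem sum_down (i j : ℕ) :
    ∑ M ∈ cornerPaths i j, (degWeight (insert ((i : ℤ) + 1, (j : ℤ)) M) : ℤ) =
      cornerWeightSum i j + cornerEndSum i j + 2 * cornerCount i j := by
  rw [Finset.sum_congr rfl fun M hM => by rw [(insert_down_weight hM).2]]
  push_cast
  rw [Finset.sum_add_distrib, Finset.sum_add_distrib, cornerWeightSum, cornerEndSum, cornerCount,
    Finset.mul_sum, mul_one]

theorem sum_right (i j : ℕ) :
    ∑ M ∈ cornerPaths i j, (degWeight (insert ((i : ℤ), (j : ℤ) + 1) M) : ℤ) =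
      cornerWeightSum i j + cornerEndSum i j + 2 * cornerCount i j := by
  rw [Finset.sum_congr rfl fun M hM => by rw [(insert_right_weight hM).2]]
  push_cast
  rw [Finset.sum_add_distrib, Finset.sum_add_distrib, cornerWeightSum, cornerEndSum, cornerCount,
    Finset.mul_sum, mul_one]

/-- Pascal's rule with an extra 1 at each step, coming from `cornerShape`. -/
theorem cornerCount_eq (i j : ℕ) : cornerCount i j = 2 * ((i + j).choose i : ℤ) - 1 := by
  induction i, j using cornerPaths.induct with
  | case1 => simp [cornerCount, cornerPaths]
  | case2 i ih =>
    rw [cornerCount, sum_cornerPaths_succ_zero]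
    simpa [cornerCount] using ih
  | case3 j ih =>
    rw [cornerCount, sum_cornerPaths_zero_succ]
    simpa [cornerCount] using ih
  | case4 i j ih1 ih2 =>
    rw [cornerCount] at *
    rw [sum_cornerPaths_succ_succ, ih1, ih2]
    have h : (i + 1 + (j + 1)).choose (i + 1) =
        (i + (j + 1)).choose i + (i + 1 + j).choose (i + 1) := by
      rw [show i + 1 + (j + 1) = (i + (j + 1)) + 1 by ring, Nat.choose_succ_succ]
      congr 2
      ring
    rw [h]
    push_cast
    ring

theorem cornerEndSum_succ_zero (i : ℕ) : cornerEndSum (i + 1) 0 = 2 := by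
  rw [cornerEndSum, sum_cornerPaths_succ_zero]
  push_cast
  have : ∀ M ∈ cornerPaths i 0,
      (2 : ℤ) ^ gridDeg (insert ((i : ℤ) + 1, 0) M) ((i : ℤ) + 1, 0) = 2 := fun M hM => by
    have := (insert_down_weight hM).1
    rw [Nat.cast_zero] at this
    rw [this, pow_one]
  rw [Finset.sum_congr rfl this]
  have h := cornerCount_eq i 0
  rw [cornerCount] at h
  rw [← mul_one (2 : ℤ), ← Finset.mul_sum, h]
  simp

theorem cornerEndSum_zero_succ (j : ℕ) : cornerEndSum 0 (j + 1) = 2 := by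
  rw [cornerEndSum, sum_cornerPaths_zero_succ]
  push_cast
  have : ∀ M ∈ cornerPaths 0 j,
      (2 : ℤ) ^ gridDeg (insert (0, (j : ℤ) + 1) M) (0, (j : ℤ) + 1) = 2 := fun M hM => by
    have := (insert_right_weight hM).1
    rw [Nat.cast_zero] at this
    rw [this, pow_one]
  rw [Finset.sum_congr rfl this]
  have h := cornerCount_eq 0 j
  rw [cornerCount] at h
  rw [← mul_one (2 : ℤ), ← Finset.mul_sum, h]
  simp

/-- The last cell has degree 1 except in `cornerShape`, where it has degree 2; the sum is twice the
count plus 2. -/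
theorem cornerEndSum_succ_succ (i j : ℕ) :
    cornerEndSum (i + 1) (j + 1) = 4 * ((i + 1 + (j + 1)).choose (i + 1) : ℤ) := by
  rw [cornerEndSum, sum_cornerPaths_succ_succ,
    (cornerShape_weight (Nat.succ_ne_zero i) (Nat.succ_ne_zero j)).1]
  have h1 : ∀ M ∈ cornerPaths i (j + 1),
      (2 : ℤ) ^ gridDeg (insert ((i : ℤ) + 1, ((j + 1 : ℕ) : ℤ)) M)
        (((i + 1 : ℕ) : ℤ), ((j + 1 : ℕ) : ℤ)) = 2 * 1 := fun M hM => by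
    rw [Nat.cast_succ i, (insert_down_weight hM).1, pow_one, mul_one]
  have h2 : ∀ M ∈ cornerPaths (i + 1) j,
      (2 : ℤ) ^ gridDeg (insert (((i + 1 : ℕ) : ℤ), (j : ℤ) + 1) M)
        (((i + 1 : ℕ) : ℤ), ((j + 1 : ℕ) : ℤ)) = 2 * 1 := fun M hM => by
    rw [Nat.cast_succ j, (insert_right_weight hM).1, pow_one, mul_one]
  have h := cornerCount_eq (i + 1) (j + 1)
  rw [cornerCount, sum_cornerPaths_succ_succ] at h
  rw [Finset.sum_congr rfl h1, Finset.sum_congr rfl h2, ← Finset.mul_sum, ← Finset.mul_sum]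
  linarith

theorem cornerWeightSum_zero_zero : cornerWeightSum 0 0 = 1 := by
  simp [cornerWeightSum, cornerPaths, degWeight_singleton]

theorem cornerEndSum_zero_zero : cornerEndSum 0 0 = 1 := by
  simp [cornerEndSum, cornerPaths, gridDeg_singleton]

theorem cornerWeightSum_succ_zero (i : ℕ) : cornerWeightSum (i + 1) 0 = 4 * (i + 1) := by
  induction i with
  | zero =>
    rw [cornerWeightSum, sum_cornerPaths_succ_zero, sum_down, cornerWeightSum_zero_zero,
      cornerEndSum_zero_zero, cornerCount_eq]
    simp
  | succ i ih =>
    rw [cornerWeightSum, sum_cornerPaths_succ_zero, sum_down, ih,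
      cornerEndSum_succ_zero, cornerCount_eq]
    simp
    ring

theorem cornerWeightSum_zero_succ (j : ℕ) : cornerWeightSum 0 (j + 1) = 4 * (j + 1) := by
  induction j with
  | zero =>
    rw [cornerWeightSum, sum_cornerPaths_zero_succ, sum_right, cornerWeightSum_zero_zero,
      cornerEndSum_zero_zero, cornerCount_eq]
    simp
  | succ j ih =>
    rw [cornerWeightSum, sum_cornerPaths_zero_succ, sum_right, ih,
      cornerEndSum_zero_succ, cornerCount_eq]
    simp
    ring

/-- An indicator of zero, correcting the general formulas on the boundary of the index range. -/
def atZero (i : ℕ) : ℤ := if i = 0 then 1 else 0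

theorem cornerEndSum_eq (i j : ℕ) : cornerEndSum i j =
    4 * ((i + j).choose i : ℤ) - 2 * atZero i - 2 * atZero j + atZero i * atZero j := by
  rcases i with _ | i <;> rcases j with _ | j
  · simp [cornerEndSum_zero_zero, atZero]
  · simp [cornerEndSum_zero_succ, atZero]
  · simp [cornerEndSum_succ_zero, atZero]
  · simp [cornerEndSum_succ_succ, atZero]

/-- The recursion involves weight and end sums only through their sum, in which the boundary
corrections cancel, so a single closed form survives the induction. -/
theorem cornerWeightSum_eq (i j : ℕ) : cornerWeightSum i j =
    (8 * ((i : ℤ) + j) + 2) * ((i + j).choose i : ℤ) - 4 * ((i : ℤ) + j) - 4 +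
      2 * atZero i + 2 * atZero j - atZero i * atZero j := by
  induction i, j using cornerPaths.induct with
  | case1 => simp [cornerWeightSum_zero_zero, atZero]
  | case2 i ih => simp [cornerWeightSum_succ_zero, atZero]; ring
  | case3 j ih => simp [cornerWeightSum_zero_succ, atZero]; ring
  | case4 i j ih1 ih2 =>
    rw [cornerWeightSum, sum_cornerPaths_succ_succ, sum_down, sum_right, ih1, ih2,
      (cornerShape_weight (Nat.succ_ne_zero i) (Nat.succ_ne_zero j)).2, cornerEndSum_eq,
      cornerEndSum_eq, cornerCount_eq, cornerCount_eq]
    have h : (i + 1 + (j + 1)).choose (i + 1) =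
        (i + (j + 1)).choose i + (i + 1 + j).choose (i + 1) := by
      rw [show i + 1 + (j + 1) = (i + (j + 1)) + 1 by ring, Nat.choose_succ_succ]
      congr 2
      ring
    rw [h]
    have e1 : atZero (i + 1) = 0 := by simp [atZero]
    have e2 : atZero (j + 1) = 0 := by simp [atZero]
    rw [e1, e2]
    push_cast
    ring

/-! ### The total weight of armed paths -/

theorem addArms_injOn {B K i j : ℕ} (hi : i < B) (hj : j < K) :
    Set.InjOn (addArms B K i j) (cornerPaths i j : Set (Finset (ℤ × ℤ))) := by
  intro M hM M' hM' h
  have key : ∀ {N : Finset (ℤ × ℤ)}, N ∈ cornerPaths i j →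
      (addArms B K i j N).filter (fun c => c.1 ≤ (i : ℤ) ∧ c.2 ≤ (j : ℤ)) = N := by
    intro N hN
    ext ⟨y, z⟩
    obtain ⟨h1, h2⟩ := slim_of_mem_cornerPaths hN
    rw [Finset.mem_filter, mem_addArms hi.le hj.le]
    constructor
    · rintro ⟨h | h | h, h3, h4⟩
      · exact h
      · have : y = i ∧ z = j := by simp only at *; omega
        rwa [this.1, this.2]
      · have : y = i ∧ z = j := by simp only at *; omega
        rwa [this.1, this.2]
    · intro h
      have := h1.fillsBox.sub _ h
      exact ⟨Or.inl h, this.2.1, this.2.2.2⟩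
  rw [← key hM, ← key hM', h]

/-- The families are disjoint: corner paths contain (B, K) and the others do not, while i and j are
recovered as the row of the cell in column K and the column of the cell in row B. -/
theorem sum_armedPaths (B K : ℕ) :
    ∑ M ∈ armedPaths B K, (degWeight M : ℤ) = cornerWeightSum B K +
      ∑ i ∈ Finset.range B, ∑ j ∈ Finset.range K, (cornerWeightSum i j + 3 * cornerEndSum i j +
        (4 * ((B : ℤ) + K - i - j) - 4) * cornerCount i j) := by
  rw [armedPaths, Finset.sum_union, Finset.sum_biUnion, Finset.sum_product]
  · congr 1
    refine Finset.sum_congr rfl fun i hi => Finset.sum_congr rfl fun j hj => ?_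
    rw [Finset.mem_range] at hi hj
    rw [Finset.sum_image (addArms_injOn hi hj),
      Finset.sum_congr rfl fun M hM => degWeight_addArms hi hj hM, cornerWeightSum, cornerEndSum,
      cornerCount, Finset.mul_sum, Finset.mul_sum, ← Finset.sum_add_distrib,
      ← Finset.sum_add_distrib]
    exact Finset.sum_congr rfl fun M _ => by ring
  · rintro ⟨i, j⟩ hp ⟨i', j'⟩ hp' hne
    rw [Function.onFun, Finset.disjoint_left]
    intro N h h'
    simp only [Finset.coe_product, Finset.coe_range, Set.mem_prod, Set.mem_Iio] at hp hp'
    obtain ⟨M, hM, rfl⟩ := Finset.mem_image.1 h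
    obtain ⟨M', hM', h'⟩ := Finset.mem_image.1 h'
    simp only at hM hM' h'
    apply hne
    have h1 : ((B : ℤ), (j : ℤ)) ∈ addArms B K i' j' M' := by
      rw [h', mem_addArms hp.1.le hp.2.le]; omega
    have h2 : ((i : ℤ), (K : ℤ)) ∈ addArms B K i' j' M' := by
      rw [h', mem_addArms hp.1.le hp.2.le]; omega
    rw [mem_addArms hp'.1.le hp'.2.le] at h1 h2
    have h3 := notMem_of_row_gt hM' (y := B) (z := j) (by omega)
    have h4 := notMem_of_col_gt hM' (y := i) (z := K) (by omega)
    rw [Prod.mk.injEq]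
    have h1 := h1.resolve_left h3
    have h2 := h2.resolve_left h4
    omega
  · rw [Finset.disjoint_left]
    intro M hM h
    obtain ⟨⟨i, j⟩, hp, h⟩ := Finset.mem_biUnion.1 h
    simp only [Finset.mem_product, Finset.mem_range] at hp
    obtain ⟨M', hM', rfl⟩ := Finset.mem_image.1 h
    have := (slim_of_mem_cornerPaths hM).2
    rw [mem_addArms hp.1.le hp.2.le] at this
    have := this.resolve_left (notMem_of_row_gt hM' (by omega))
    omega

theorem sum_atZero (B : ℕ) : ∑ i ∈ Finset.range (B + 1), atZero i = 1 := by
  rw [Finset.sum_range_succ']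
  simp [atZero]

theorem sum_choose_row (K i : ℕ) :
    ∑ j ∈ Finset.range K, ((i + j).choose i : ℤ) = (i + K).choose (i + 1) := by
  induction K with
  | zero => simp
  | succ K ih =>
    rw [Finset.sum_range_succ, ih, ← add_assoc, Nat.choose_succ_succ]
    push_cast
    ring

theorem sum_choose_box (B K : ℕ) :
    ∑ i ∈ Finset.range B, ∑ j ∈ Finset.range K, ((i + j).choose i : ℤ) =
      ((B + K).choose B : ℤ) - 1 := by
  induction B with
  | zero => simp
  | succ B ih =>
    rw [Finset.sum_range_succ, ih, sum_choose_row, show B + 1 + K = (B + K) + 1 by ring,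
      Nat.choose_succ_succ]
    push_cast
    ring

theorem sum_armedPaths_eq (B K : ℕ) :
    ∑ M ∈ armedPaths (B + 1) (K + 1), (degWeight M : ℤ) =
      (16 * ((B : ℤ) + K + 2) + 8) * ((B + 1 + (K + 1)).choose (B + 1) : ℤ) -
        12 * ((B : ℤ) + K + 2) - 16 - 4 * ((B : ℤ) + K + 2) * (B + 1) * (K + 1) -
        4 * ((B : ℤ) + K) := by
  rw [sum_armedPaths]
  -- The coefficients depending on i + j cancel, leaving only sums of plain binomial coefficients
  -- and boundary indicators.
  have hterm : ∀ i j : ℕ, cornerWeightSum i j + 3 * cornerEndSum i j +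
      (4 * (((B + 1 : ℕ) : ℤ) + ((K + 1 : ℕ) : ℤ) - i - j) - 4) * cornerCount i j =
      (8 * ((B : ℤ) + K + 2) + 6) * ((i + j).choose i : ℤ) - 4 * ((B : ℤ) + K + 2) -
        4 * atZero i - 4 * atZero j + 2 * (atZero i * atZero j) := by
    intro i j
    rw [cornerWeightSum_eq, cornerEndSum_eq, cornerCount_eq]
    push_cast
    ring
  simp only [hterm]
  simp only [Finset.sum_add_distrib, Finset.sum_sub_distrib, ← Finset.mul_sum, Finset.sum_const,
    Finset.card_range, sum_atZero, sum_choose_box, cornerWeightSum_eq, nsmul_eq_mul, mul_one]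
  have e1 : atZero (B + 1) = 0 := by simp [atZero]
  have e2 : atZero (K + 1) = 0 := by simp [atZero]
  rw [e1, e2]
  push_cast
  ring

/-! ### Mirror images within the box -/

theorem StairPath.translate {a b i j : ℤ} {S : ℤ → ℤ → Prop} (h : StairPath a b i j S) (t : ℤ) :
    StairPath a (b + t) i (j + t) fun y z => S y (z - t) := by
  induction h with
  | nil => exact nil.congr fun y z => by omega
  | down h ih => exact ih.down.congr fun y z => or_congr Iff.rfl (by omega)
  | right h ih =>
    rw [add_right_comm]
    exact ih.right.congr fun y z => or_congr Iff.rfl (by omega)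

/-- The reflection z ↦ -z moves the box; a translation by K brings it back. -/
theorem IsArmedPath.translate {M : ℤ → ℤ → Prop} (h : IsArmedPath M) (t : ℤ) :
    IsArmedPath fun y z => M y (z - t) := by
  obtain ⟨a, b, i, j, S, l, u, r, d, hS, hM⟩ := h
  refine ⟨a, b + t, i, j + t, _, l, u, r, d, hS.translate t, fun y z => ?_⟩
  beta_reduce
  rw [hM]
  refine or_congr Iff.rfl ?_
  omega

/-- The mirror image of `M` that maps column `z` to column `t - z`. -/
def mirror (t : ℤ) (M : Finset (ℤ × ℤ)) : Finset (ℤ × ℤ) := M.image fun p => (p.1, t - p.2)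

theorem mem_mirror {t y z : ℤ} {M : Finset (ℤ × ℤ)} : (y, z) ∈ mirror t M ↔ (y, t - z) ∈ M := by
  simp only [mirror, Finset.mem_image, Prod.mk.injEq, Prod.exists]
  constructor
  · rintro ⟨a, b, h, rfl, rfl⟩
    rwa [sub_sub_cancel]
  · intro h
    exact ⟨y, t - z, h, rfl, sub_sub_cancel _ _⟩

theorem mirror_mirror (t : ℤ) (M : Finset (ℤ × ℤ)) : mirror t (mirror t M) = M := by
  ext ⟨y, z⟩
  rw [mem_mirror, mem_mirror, sub_sub_cancel]

theorem mirror_insert (t : ℤ) (p : ℤ × ℤ) (M : Finset (ℤ × ℤ)) :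
    mirror t (insert p M) = insert (p.1, t - p.2) (mirror t M) := Finset.image_insert _ _ _

theorem Slim.mirror {y₀ y₁ z₀ z₁ : ℤ} {M : Finset (ℤ × ℤ)} (h : Slim y₀ y₁ z₀ z₁ M) (t : ℤ) :
    Slim y₀ y₁ (t - z₁) (t - z₀) (mirror t M) := by
  induction h with
  | single y z => simpa [_root_.mirror] using Slim.single y (t - z)
  | down h hm ih =>
    rw [mirror_insert]
    exact ih.down (mem_mirror.2 (by rwa [sub_sub_cancel]))
  | up h hm ih =>
    rw [mirror_insert]
    exact ih.up (mem_mirror.2 (by rwa [sub_sub_cancel]))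
  | right h hm ih =>
    rw [mirror_insert, ← sub_sub]
    exact ih.left (mem_mirror.2 (by rwa [sub_sub_cancel]))
  | left h hm ih =>
    rw [mirror_insert, ← sub_add]
    exact ih.right (mem_mirror.2 (by rwa [sub_sub_cancel]))

theorem degWeight_mirror (t : ℤ) (M : Finset (ℤ × ℤ)) : degWeight (mirror t M) = degWeight M := by
  have hinj : Function.Injective fun p : ℤ × ℤ => (p.1, t - p.2) := by
    rintro ⟨a, b⟩ ⟨c, d⟩ h
    simp only [Prod.mk.injEq] at h ⊢
    omega
  rw [degWeight, mirror, Finset.sum_image fun _ _ _ _ h => hinj h, degWeight]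
  refine Finset.sum_congr rfl fun v _ => ?_
  congr 1
  rw [gridDeg, gridDeg, Finset.filter_image, Finset.card_image_of_injective _ hinj]
  congr 1
  refine Finset.filter_congr fun q _ => ?_
  simp only [GridAdj]
  omega

/-- The slim sets in a box are the armed paths and their mirror images. -/
theorem slim_iff_mem_armedPaths {B K : ℕ} {M : Finset (ℤ × ℤ)} :
    Slim 0 B 0 K M ↔ M ∈ armedPaths B K ∪ (armedPaths B K).image (mirror K) := by
  have himg : M ∈ (armedPaths B K).image (mirror K) ↔ mirror K M ∈ armedPaths B K := by
    rw [Finset.mem_image]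
    refine ⟨?_, fun h => ⟨_, h, mirror_mirror _ _⟩⟩
    rintro ⟨N, hN, rfl⟩
    rwa [mirror_mirror]
  rw [Finset.mem_union, himg]
  constructor
  · intro h
    have h' := h.mirror K
    rw [sub_self, sub_zero] at h'
    refine h.isArmedPathOrMirror.imp (fun hM => hM.mem_armedPaths h.fillsBox) fun hM => ?_
    refine IsArmedPath.mem_armedPaths h'.fillsBox ((hM.translate K).congr fun y z => ?_)
    rw [mem_mirror, neg_sub]
  · rintro (h | h)
    · exact slim_of_mem_armedPaths h
    · have := (slim_of_mem_armedPaths h).mirror K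
      rwa [sub_self, sub_zero, mirror_mirror] at this

/-! ### Sets counted in both orientations are crosses -/

/-- Going to the right, the edges of `M` between consecutive columns never go up, and going down,
the edges between consecutive rows never go left. -/
structure MonoEdges (M : Finset (ℤ × ℤ)) : Prop where
  rows : ∀ y z y' z', (y, z) ∈ M → (y, z + 1) ∈ M → (y', z') ∈ M → (y', z' + 1) ∈ M →
    z < z' → y ≤ y'
  cols : ∀ y z y' z', (y, z) ∈ M → (y + 1, z) ∈ M → (y', z') ∈ M → (y' + 1, z') ∈ M →
    y < y' → z ≤ z'

/-- The only new edge joins rows i and i + 1 in the last column, so it lies weakly to the right of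
all earlier ones. -/
theorem MonoEdges.insert_down {i j : ℕ} {M : Finset (ℤ × ℤ)} (h : MonoEdges M)
    (hM : M ∈ cornerPaths i j) : MonoEdges (insert ((i : ℤ) + 1, (j : ℤ)) M) := by
  have hs : ∀ y z, (y, z) ∈ M → 0 ≤ y ∧ y ≤ i ∧ 0 ≤ z ∧ z ≤ j := fun y z h =>
    (slim_of_mem_cornerPaths hM).1.fillsBox.sub _ h
  obtain ⟨h1, h2⟩ := h
  constructor
  · intro y z y' z' a b c d hlt
    simp only [Finset.mem_insert, Prod.mk.injEq] at a b c d
    grind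
  · intro y z y' z' a b c d hlt
    simp only [Finset.mem_insert, Prod.mk.injEq] at a b c d
    grind

theorem MonoEdges.insert_right {i j : ℕ} {M : Finset (ℤ × ℤ)} (h : MonoEdges M)
    (hM : M ∈ cornerPaths i j) : MonoEdges (insert ((i : ℤ), (j : ℤ) + 1) M) := by
  have hs : ∀ y z, (y, z) ∈ M → 0 ≤ y ∧ y ≤ i ∧ 0 ≤ z ∧ z ≤ j := fun y z h =>
    (slim_of_mem_cornerPaths hM).1.fillsBox.sub _ h
  obtain ⟨h1, h2⟩ := h
  constructor
  · intro y z y' z' a b c d hlt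
    simp only [Finset.mem_insert, Prod.mk.injEq] at a b c d
    grind
  · intro y z y' z' a b c d hlt
    simp only [Finset.mem_insert, Prod.mk.injEq] at a b c d
    grind

theorem monoEdges_of_mem_cornerPaths {i j : ℕ} {M : Finset (ℤ × ℤ)} (h : M ∈ cornerPaths i j) :
    MonoEdges M := by
  induction i, j using cornerPaths.induct generalizing M with
  | case1 =>
    rw [cornerPaths, Finset.mem_singleton] at h
    subst h
    constructor <;> intro y z y' z' a b <;> simp at a b <;> omega
  | case2 i ih =>
    rw [cornerPaths, Finset.mem_image] at h
    obtain ⟨M, hM, rfl⟩ := h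
    exact (ih hM).insert_down hM
  | case3 j ih =>
    rw [cornerPaths, Finset.mem_image] at h
    obtain ⟨M, hM, rfl⟩ := h
    exact (ih hM).insert_right hM
  | case4 i j ih1 ih2 =>
    rw [cornerPaths, Finset.mem_union, Finset.mem_union, Finset.mem_image, Finset.mem_image,
      Finset.mem_singleton] at h
    rcases h with (⟨M, hM, rfl⟩ | ⟨M, hM, rfl⟩) | rfl
    · have := (ih1 hM).insert_down hM
      push_cast at this
      exact this
    · have := (ih2 hM).insert_right hM
      push_cast at this
      exact this
    · constructor <;> intro y z y' z' a b c d <;> rw [mem_cornerShape] at a b c d <;> omega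

theorem monoEdges_of_mem_armedPaths {B K : ℕ} {M : Finset (ℤ × ℤ)} (h : M ∈ armedPaths B K) :
    MonoEdges M := by
  rcases mem_armedPaths.1 h with h | ⟨i, hi, j, hj, M, hM, rfl⟩
  · exact monoEdges_of_mem_cornerPaths h
  have hs : ∀ y z, (y, z) ∈ M → 0 ≤ y ∧ y ≤ i ∧ 0 ≤ z ∧ z ≤ j := fun y z h =>
    (slim_of_mem_cornerPaths hM).1.fillsBox.sub _ h
  obtain ⟨h1, h2⟩ := monoEdges_of_mem_cornerPaths hM
  have hend := (slim_of_mem_cornerPaths hM).2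
  have hrow : ∀ y z, (y, z) ∈ addArms B K i j M → (y, z + 1) ∈ addArms B K i j M →
      ((y, z) ∈ M ∧ (y, z + 1) ∈ M) ∨ (y = i ∧ (j : ℤ) ≤ z) := by
    intro y z a b
    rw [mem_addArms hi.le hj.le] at a b
    by_cases hz : (j : ℤ) ≤ z
    · right
      refine ⟨?_, hz⟩
      rcases b with b | b | b
      · have := hs _ _ b; omega
      · exact b.1
      · omega
    · left
      refine ⟨a.resolve_right (by omega), ?_⟩
      rcases b with b | b | b
      · exact b
      · have : y = i ∧ z + 1 = j := by omega
        rwa [this.1, this.2]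
      · have := hs _ _ (a.resolve_right (by omega))
        have : y = i ∧ z + 1 = j := by omega
        rwa [this.1, this.2]
  have hcol : ∀ y z, (y, z) ∈ addArms B K i j M → (y + 1, z) ∈ addArms B K i j M →
      ((y, z) ∈ M ∧ (y + 1, z) ∈ M) ∨ (z = j ∧ (i : ℤ) ≤ y) := by
    intro y z a b
    rw [mem_addArms hi.le hj.le] at a b
    by_cases hy : (i : ℤ) ≤ y
    · right
      refine ⟨?_, hy⟩
      rcases b with b | b | b
      · have := hs _ _ b; omega
      · omega
      · exact b.1
    · left
      refine ⟨a.resolve_right (by omega), ?_⟩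
      rcases b with b | b | b
      · exact b
      · have := hs _ _ (a.resolve_right (by omega))
        have : y + 1 = i ∧ z = j := by omega
        rwa [this.1, this.2]
      · have : y + 1 = i ∧ z = j := by omega
        rwa [this.1, this.2]
  constructor
  · intro y z y' z' a b c d hlt
    rcases hrow _ _ a b with h | h <;> rcases hrow _ _ c d with h' | h'
    · exact h1 _ _ _ _ h.1 h.2 h'.1 h'.2 hlt
    · have := hs _ _ h.1; omega
    · have := hs _ _ h'.2; omega
    · omega
  · intro y z y' z' a b c d hlt
    rcases hcol _ _ a b with h | h <;> rcases hcol _ _ c d with h' | h'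
    · exact h2 _ _ _ _ h.1 h.2 h'.1 h'.2 hlt
    · have := hs _ _ h.1; omega
    · have := hs _ _ h'.2; omega
    · omega

/-- The union of row `r` and column `c` of the box with rows `0, …, B` and columns `0, …, K`. -/
def crossShape (B K r c : ℕ) : Finset (ℤ × ℤ) :=
  ((({((r : ℤ), (c : ℤ))} ∪ arm (r, c) (0, -1) c) ∪ arm (r, c) (0, 1) (K - c)) ∪
    arm (r, c) (-1, 0) r) ∪ arm (r, c) (1, 0) (B - r)

theorem mem_crossShape {B K r c : ℕ} (hr : r ≤ B) (hc : c ≤ K) {y z : ℤ} :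
    (y, z) ∈ crossShape B K r c ↔ (y = r ∧ 0 ≤ z ∧ z ≤ K) ∨ (z = c ∧ 0 ≤ y ∧ y ≤ B) := by
  simp only [crossShape, Finset.mem_union, mem_arm_left, mem_arm_right, mem_arm_up, mem_arm_down,
    Finset.mem_singleton, Prod.mk.injEq]
  omega

/-- The number of arms of nonzero length at position `r` of a segment `0, …, B`. -/
def armCount (B r : ℕ) : ℕ := (if r = 0 then 0 else 1) + if B - r = 0 then 0 else 1

/-- Four arms are attached to a single cell, for which the invariant of `gridDeg_union_arm` is 0. -/
theorem degWeight_crossShape {B K r c : ℕ} (hr : r ≤ B) (hc : c ≤ K) :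
    (degWeight (crossShape B K r c) : ℤ) =
      2 ^ armCount B r * 2 ^ armCount K c - 2 * armCount B r - 2 * armCount K c +
        4 * ((B : ℤ) + K) := by
  have m0 : ((r : ℤ), (c : ℤ)) ∈ ({((r : ℤ), (c : ℤ))} : Finset (ℤ × ℤ)) :=
    Finset.mem_singleton_self _
  have m1 := Finset.mem_union_left (arm (r, c) (0, -1) c) m0
  have m2 := Finset.mem_union_left (arm (r, c) (0, 1) (K - c)) m1
  have m3 := Finset.mem_union_left (arm (r, c) (-1, 0) r) m2
  obtain ⟨a1, b1, -⟩ := gridDeg_union_arm (e := (0, -1)) (Or.inr (Or.inl rfl)) m0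
    (fun p hp => by rw [Finset.mem_singleton.1 hp]) c
  obtain ⟨a2, b2, -⟩ := gridDeg_union_arm (e := (0, 1)) (Or.inl rfl) m1
    (fun p hp => by
      obtain ⟨y, z⟩ := p
      simp only [Finset.mem_union, mem_arm_left, Finset.mem_singleton, Prod.mk.injEq] at hp
      simp only; omega) (K - c)
  obtain ⟨a3, b3, -⟩ := gridDeg_union_arm (e := (-1, 0)) (Or.inr (Or.inr (Or.inr rfl))) m2
    (fun p hp => by
      obtain ⟨y, z⟩ := p
      simp only [Finset.mem_union, mem_arm_left, mem_arm_right, Finset.mem_singleton,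
        Prod.mk.injEq] at hp
      simp only; omega) r
  obtain ⟨a4, b4, -⟩ := gridDeg_union_arm (e := (1, 0)) (Or.inr (Or.inr (Or.inl rfl))) m3
    (fun p hp => by
      obtain ⟨y, z⟩ := p
      simp only [Finset.mem_union, mem_arm_left, mem_arm_right, mem_arm_up, Finset.mem_singleton,
        Prod.mk.injEq] at hp
      simp only; omega) (B - r)
  rw [gridDeg_singleton, zero_add] at a1
  rw [gridDeg_singleton, degWeight_singleton] at b1
  have hg : gridDeg (crossShape B K r c) (r, c) = armCount B r + armCount K c := by
    rw [crossShape, a4, a3, a2, a1, armCount, armCount]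
    ring
  rw [← crossShape, hg, b3, b2, b1, pow_add] at b4
  have e1 : ((B - r : ℕ) : ℤ) = B - r := by omega
  have e2 : ((K - c : ℕ) : ℤ) = K - c := by omega
  rw [e1, e2] at b4
  push_cast at b4
  linarith

theorem isArmedPath_crossShape {B K r c : ℕ} (hr : r ≤ B) (hc : c ≤ K) :
    IsArmedPath fun y z => (y, z) ∈ crossShape B K r c := by
  refine ⟨r, c, r, c, _, c, r, K - c, B - r, StairPath.nil, fun y z => ?_⟩
  beta_reduce
  rw [mem_crossShape hr hc]
  omega

theorem crossShape_mem_armedPaths {B K r c : ℕ} (hr : r ≤ B) (hc : c ≤ K) :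
    crossShape B K r c ∈ armedPaths B K := by
  refine (isArmedPath_crossShape hr hc).mem_armedPaths ⟨?_, ⟨c, ?_⟩, ⟨c, ?_⟩, ⟨r, ?_⟩, ⟨r, ?_⟩⟩
  · rintro ⟨y, z⟩ h
    rw [mem_crossShape hr hc] at h
    simp only
    omega
  all_goals
    rw [mem_crossShape hr hc]
    omega

theorem mirror_crossShape {B K r c : ℕ} (hr : r ≤ B) (hc : c ≤ K) :
    mirror K (crossShape B K r c) = crossShape B K r (K - c) := by
  ext ⟨y, z⟩
  rw [mem_mirror, mem_crossShape hr hc, mem_crossShape hr (Nat.sub_le _ _)]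
  omega

/-- Monotonicity of M and of its mirror image puts all edges between columns in one row and all
edges between rows in one column. So M contains a cross, and both have B + K + 1 cells. -/
theorem exists_eq_crossShape {B K : ℕ} (hB : 1 ≤ B) (hK : 1 ≤ K) {M : Finset (ℤ × ℤ)}
    (h : M ∈ armedPaths B K) (h' : mirror K M ∈ armedPaths B K) :
    ∃ r ≤ B, ∃ c ≤ K, crossShape B K r c = M := by
  have hs := slim_of_mem_armedPaths h
  have hm := monoEdges_of_mem_armedPaths h
  have hm' := monoEdges_of_mem_armedPaths h'
  obtain ⟨r, hr0, hr1⟩ := hs.exists_col_edge le_rfl (by omega : (0 : ℤ) < K)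
  obtain ⟨c, hc0, hc1⟩ := hs.exists_row_edge le_rfl (by omega : (0 : ℤ) < B)
  have hbr := hs.fillsBox.sub _ hr0
  have hbc := hs.fillsBox.sub _ hc0
  simp only at hbr hbc
  have hrow : ∀ z : ℤ, 0 ≤ z → z < K → (r, z) ∈ M ∧ (r, z + 1) ∈ M := by
    intro z h0 h1
    obtain ⟨y, hy0, hy1⟩ := hs.exists_col_edge h0 h1
    rcases h0.eq_or_lt with rfl | h0
    · exact ⟨hr0, hr1⟩
    have e1 := hm.rows r 0 y z hr0 hr1 hy0 hy1 h0
    have e2 := hm'.rows y (K - (z + 1)) r (K - (0 + 1)) (by rwa [mem_mirror, sub_sub_cancel])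
      (by rw [mem_mirror]; convert hy0 using 2; ring)
      (by rwa [mem_mirror, sub_sub_cancel])
      (by rw [mem_mirror]; convert hr0 using 2; ring) (by omega)
    rw [le_antisymm e1 e2]
    exact ⟨hy0, hy1⟩
  have hcol : ∀ y : ℤ, 0 ≤ y → y < B → (y, c) ∈ M ∧ (y + 1, c) ∈ M := by
    intro y h0 h1
    obtain ⟨z, hz0, hz1⟩ := hs.exists_row_edge h0 h1
    rcases h0.eq_or_lt with rfl | h0
    · exact ⟨hc0, hc1⟩
    have e1 := hm.cols 0 c y z hc0 hc1 hz0 hz1 h0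
    have e2 := hm'.cols 0 (K - c) y (K - z) (by rwa [mem_mirror, sub_sub_cancel])
      (by rwa [mem_mirror, sub_sub_cancel]) (by rwa [mem_mirror, sub_sub_cancel])
      (by rwa [mem_mirror, sub_sub_cancel]) h0
    obtain rfl : c = z := by omega
    exact ⟨hz0, hz1⟩
  obtain ⟨r, rfl⟩ := Int.eq_ofNat_of_zero_le hbr.1
  obtain ⟨c, rfl⟩ := Int.eq_ofNat_of_zero_le hbc.2.2.1
  have hrB : r ≤ B := by omega
  have hcK : c ≤ K := by omega
  refine ⟨r, hrB, c, hcK, Finset.eq_of_subset_of_card_le ?_ ?_⟩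
  · rintro ⟨y, z⟩ hyz
    rw [mem_crossShape hrB hcK] at hyz
    rcases hyz with ⟨rfl, h0, h1⟩ | ⟨rfl, h0, h1⟩
    · rcases h1.lt_or_eq with h1 | rfl
      · exact (hrow z h0 h1).1
      · have := (hrow ((K : ℤ) - 1) (by omega) (by omega)).2
        rwa [sub_add_cancel] at this
    · rcases h1.lt_or_eq with h1 | rfl
      · exact (hcol y h0 h1).1
      · have := (hcol ((B : ℤ) - 1) (by omega) (by omega)).2
        rwa [sub_add_cancel] at this
  · have h1 := hs.card_eq
    have h2 := (slim_of_mem_armedPaths (crossShape_mem_armedPaths hrB hcK)).card_eq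
    omega

theorem crossShape_injOn {B K : ℕ} (hB : 1 ≤ B) (hK : 1 ≤ K) :
    Set.InjOn (fun p : ℕ × ℕ => crossShape B K p.1 p.2)
      (Finset.range (B + 1) ×ˢ Finset.range (K + 1) : Finset (ℕ × ℕ)) := by
  rintro ⟨r, c⟩ hp ⟨r', c'⟩ hp' h
  simp only [Finset.coe_product, Finset.coe_range, Set.mem_prod, Set.mem_Iio] at hp hp'
  simp only at h
  have key : ∀ y z, ((y, z) ∈ crossShape B K r c ↔ (y, z) ∈ crossShape B K r' c') := by
    intro y z; rw [h]
  simp only [mem_crossShape (Nat.le_of_lt_succ hp.1) (Nat.le_of_lt_succ hp.2),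
    mem_crossShape (Nat.le_of_lt_succ hp'.1) (Nat.le_of_lt_succ hp'.2)] at key
  -- Two cells of a row cannot both lie in the other cross's column; hence the rows agree, and
  -- likewise the columns. This needs B, K ≥ 1.
  have h1 := key r 0
  have h2 := key r 1
  have h3 := key 0 c
  have h4 := key 1 c
  rw [Prod.mk.injEq]
  omega

theorem armedPaths_inter_mirror {B K : ℕ} (hB : 1 ≤ B) (hK : 1 ≤ K) :
    armedPaths B K ∩ (armedPaths B K).image (mirror K) =
      (Finset.range (B + 1) ×ˢ Finset.range (K + 1)).image fun p => crossShape B K p.1 p.2 := by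
  ext M
  simp only [Finset.mem_inter, Finset.mem_image, Finset.mem_product, Finset.mem_range, Prod.exists]
  constructor
  · rintro ⟨h, N, hN, rfl⟩
    obtain ⟨r, hr, c, hc, h⟩ := exists_eq_crossShape hB hK h (by rwa [mirror_mirror])
    exact ⟨r, c, by omega, h⟩
  · rintro ⟨r, c, ⟨hr, hc⟩, rfl⟩
    rw [Nat.lt_succ_iff] at hr hc
    exact ⟨crossShape_mem_armedPaths hr hc, crossShape B K r (K - c),
      crossShape_mem_armedPaths hr (Nat.sub_le _ _),
      by rw [← mirror_crossShape hr hc, mirror_mirror]⟩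

/-! ### Inclusion-exclusion and the final formula -/

theorem armCount_inner {B r : ℕ} (hr : r < B) : armCount (B + 1) (r + 1) = 2 := by
  rw [armCount, if_neg (by omega), if_neg (by omega)]

theorem sum_armCount (B : ℕ) :
    ∑ r ∈ Finset.range (B + 2), (armCount (B + 1) r : ℤ) = 2 * (B + 1) := by
  rw [Finset.sum_range_succ, Finset.sum_range_succ', Finset.sum_congr rfl fun r hr => by
    rw [armCount_inner (Finset.mem_range.1 hr)]]
  simp [armCount]
  ring

theorem sum_two_pow_armCount (B : ℕ) :
    ∑ r ∈ Finset.range (B + 2), (2 : ℤ) ^ armCount (B + 1) r = 4 * (B + 1) := by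
  rw [Finset.sum_range_succ, Finset.sum_range_succ', Finset.sum_congr rfl fun r hr => by
    rw [armCount_inner (Finset.mem_range.1 hr)]]
  simp [armCount]
  ring

theorem sum_crossShape (B K : ℕ) :
    ∑ M ∈ (Finset.range (B + 2) ×ˢ Finset.range (K + 2)).image
        (fun p => crossShape (B + 1) (K + 1) p.1 p.2), (degWeight M : ℤ) =
      16 * ((B : ℤ) + 1) * (K + 1) - 4 * (B + 1) * (K + 2) - 4 * (K + 1) * (B + 2) +
        4 * ((B : ℤ) + K + 2) * (B + 2) * (K + 2) := by
  rw [Finset.sum_image (crossShape_injOn (Nat.le_add_left 1 B) (Nat.le_add_left 1 K)),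
    Finset.sum_product]
  rw [Finset.sum_congr rfl fun r hr => Finset.sum_congr rfl fun c hc => degWeight_crossShape
    (Nat.le_of_lt_succ (Finset.mem_range.1 hr)) (Nat.le_of_lt_succ (Finset.mem_range.1 hc))]
  simp only [Finset.sum_add_distrib, Finset.sum_sub_distrib, ← Finset.mul_sum, Finset.sum_const,
    Finset.card_range, ← Finset.sum_mul, sum_armCount, sum_two_pow_armCount, nsmul_eq_mul]
  push_cast
  ring

theorem sum_slim (B K : ℕ) :
    ∑ M ∈ armedPaths (B + 1) (K + 1) ∪
        (armedPaths (B + 1) (K + 1)).image (mirror ((K + 1 : ℕ) : ℤ)), (degWeight M : ℤ) =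
      2 * ∑ M ∈ armedPaths (B + 1) (K + 1), (degWeight M : ℤ) -
        (16 * ((B : ℤ) + 1) * (K + 1) - 4 * (B + 1) * (K + 2) - 4 * (K + 1) * (B + 2) +
          4 * ((B : ℤ) + K + 2) * (B + 2) * (K + 2)) := by
  have h := Finset.sum_union_inter (s₁ := armedPaths (B + 1) (K + 1))
    (s₂ := (armedPaths (B + 1) (K + 1)).image (mirror ((K + 1 : ℕ) : ℤ)))
    (f := fun M => (degWeight M : ℤ))
  rw [armedPaths_inter_mirror (Nat.le_add_left 1 B) (Nat.le_add_left 1 K), sum_crossShape,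
    Finset.sum_image fun M _ M' _ h => by
      rw [← mirror_mirror ((K + 1 : ℕ) : ℤ) M, h, mirror_mirror]] at h
  simp only [degWeight_mirror] at h
  linarith

theorem proposition6 (b k : ℕ) (hb : 2 ≤ b) (hk : 2 ≤ k) :
    (numMinPolyominoes 2 b k : ℤ) =
      (16 * ((b + k - 2).choose (b - 1) : ℤ) - 4 * ((b : ℤ) + k)) * (2 * (b : ℤ) + 2 * k - 3)
        + 4 * ((b : ℤ) - 2) * ((k : ℤ) - 2)
        + (16 * ((b : ℤ) + k - 2) - 12 * (b : ℤ) * k) * ((b : ℤ) + k - 1) := by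
  -- With b = B + 2 and k = K + 2, the box has rows 0, …, B + 1 and columns 0, …, K + 1.
  obtain ⟨B, rfl⟩ := Nat.exists_eq_add_of_le' hb
  obtain ⟨K, rfl⟩ := Nat.exists_eq_add_of_le' hk
  have hF : ∀ M, M ∈ armedPaths (B + 1) (K + 1) ∪
      (armedPaths (B + 1) (K + 1)).image (mirror ((K + 1 : ℕ) : ℤ)) ↔
      Slim 0 (((B + 2 : ℕ) : ℤ) - 1) 0 (((K + 2 : ℕ) : ℤ) - 1) M := by
    intro M
    rw [← slim_iff_mem_armedPaths]
    have e1 : ((B + 1 : ℕ) : ℤ) = ((B + 2 : ℕ) : ℤ) - 1 := by push_cast; ring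
    have e2 : ((K + 1 : ℕ) : ℤ) = ((K + 2 : ℕ) : ℤ) - 1 := by push_cast; ring
    rw [e1, e2]
  have hne : (armedPaths (B + 1) (K + 1) ∪
      (armedPaths (B + 1) (K + 1)).image (mirror ((K + 1 : ℕ) : ℤ))).Nonempty :=
    ⟨_, Finset.mem_union_left _ (crossShape_mem_armedPaths (Nat.zero_le _) (Nat.zero_le _))⟩
  rw [numMinPolyominoes_two hne hF, Nat.cast_sum, sum_slim, sum_armedPaths_eq,
    show B + 2 + (K + 2) - 2 = B + 1 + (K + 1) by omega, show B + 2 - 1 = B + 1 by omega]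
  push_cast
  ring
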